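/- A Markov chain $\mathcal M=(S,p)$ is *divergent* with respect to $s_0\in S$ and $A\subseteq S$ if there are computable functions $f_0,f_1:S\to\mathbb R_{\ge 0}$ such that (i) for all $0<\theta<1$, $\mathbf{Pr}_{s_0}(\text{the path reaches } f_0^{-1}([0,\theta]))\le\theta$; (ii) for all $s\in S$, $\mathbf{Pr}_{s}(\text{the path reaches }A)\le f_1(s)$; (iii) for all $0<\theta<1$, only finitely many states $s$ reachable from $s_0$ satisfy $f_0(s)\ge\theta$ and $f_1(s)\ge\theta$. A *polynomial random walk* is a Markov chain on $\mathbb N$ which from $0$ moves to $1$ with probability $1$, and from $n>0$ moves to $n+1$ or $n-1$ with probabilities $\frac{W(n,n+1)}{W(n,n+1)+W(n,n-1)}$ and $\frac{W(n,n-1)}{W(n,n+1)+W(n,n-1)}$, where $W(n,n-1)=\sum_{i\le d}a_i n^i$ and $W(n,n+1)=\sum_{i\le d'}a'_i n^i$ are polynomials in $n$ of degrees $d,d'$ with coefficients in $\mathbb N$ and positive constant coefficients. Put $\rho_n=W(n,n-1)/W(n,n+1)$; let $i_0=\max\{i: a_i\ne a'_i\}$ if the two polynomials differ and, if $d=d'\ge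 1$, let $\alpha_W=\frac{a'_{d-1}-a_{d-1}}{a_d}$. **Theorem.** 1. Every polynomial random walk is irreducible. All its states are recurrent exactly in the following cases (and otherwise they are all transient): $d'<d$; or $d'=d$, $i_0$ exists and $a_{i_0}>a'_{i_0}$; or $W(n,n+1)=W(n,n-1)$ identically; or $d'=d$, $i_0$ exists, $a_{i_0}<a'_{i_0}$ and $i_0\le d-2$; or $d'=d$, $i_0$ exists, $i_0=d-1$ and $0<\alpha_W\le 1$. All its states are transient exactly in the following cases: (P) $d'=d$, $i_0$ exists, $i_0=d-1$ and $\alpha_W>1$; (G) $d<d'$, or $d=d'$ and $a_d<a'_d$. 2. A recurrent polynomial random walk is not divergent with respect to any $s_0$ and any nonempty $A\subseteq\mathbb N$. 3. A transient polynomial random walk is divergent with respect to any $s_0$ and any finite $A\subseteq\mathbb N$. 4. If the walk is transient, then for all $t\le n$ the series below converge and $$\mathbf{Pr}_n(\text{the path reaches } t)=\frac{\sum_{m\ge n}\prod_{t<k\le m}\rho_k}{\sum_{m\ge t}\prod_{t<k\le m}\rho_k}.$$ In case (G) there are $0<\alpha<1$ and $n_0\in\mathbb N$ such that $\rho_n\le\alpha$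 for all $n\ge n_0$ and, for all $t$ and all $n\ge N:=\max(n_0,t)$, $\mathbf{Pr}_n(\text{the path reaches } t)\le\frac{\alpha^{\,n-N}}{1-\alpha}$. In case (P), for every real $\beta$ with $1<\beta<\alpha_W$ there is $n_0\ge 1$ such that $\rho_n\le 1-\beta/n$ for all $n\ge n_0$ and, for all $t$ and all $n\ge N:=\max(n_0,t)$, $\mathbf{Pr}_n(\text{the path reaches } t)\le\frac{(N+1)^{\beta}}{(\beta-1)\,n^{\beta-1}}$. 5. The divergence problem for polynomial random walks is decidable in linear time: there are a multitape Turing machine (a machine with finite control and finitely many stacks) and a constant $c$ such that, given a polynomial random walk (the lists of the coefficients of both weights, in binary), an initial state $s_0$ (in binary) and a finite or cofinite set $A\subseteq\mathbb N$ (a finite list of elements and, possibly, the least element $k$ of a ray $\{n: n\ge k\}$, all in binary), encoded as a word $w$, the machine halts after at most $c(|w|+1)$ steps and answers whether the walk is divergent with respect to $s_0$ and $A$. -/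

import Mathlib

open MeasureTheory ProbabilityTheory Polynomial
open scoped NNReal ENNReal

/-! ### Markov chains -/

/-- A Markov chain with state space `S`: every row `p s` is a probability distribution on `S`. -/
structure MarkovChain (S : Type*) where
  p : S → S → ℝ≥0
  hasSum_p : ∀ s, HasSum (p s) 1

namespace MarkovChain

noncomputable section

variable {S : Type*} (M : MarkovChain S)

/-- One-step reachability `s → s'`. -/
def Step (s s' : S) : Prop := 0 < M.p s s'

/-- `Post*({s₀})`, the set of states reachable from `s₀`. -/
def postStar (s₀ : S) : Set S := {s | Relation.ReflTransGen M.Step s₀ s}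

def Irreducible : Prop := ∀ s s' : S, s' ∈ M.postStar s

/-- The row of `s` as a probability mass function. -/
def row (s : S) : PMF S :=
  ⟨fun s' => (M.p s s' : ℝ≥0∞), by
    simpa using ENNReal.hasSum_coe.2 (M.hasSum_p s)⟩

variable [Countable S] [MeasurableSpace S] [DiscreteMeasurableSpace S]

/-- The kernel that draws the next state from the current one, given the history up to time `n`. -/
def nextKernel (n : ℕ) : Kernel (Finset.Iic n → S) S where
  toFun h := (M.row (h ⟨n, Finset.mem_Iic.2 le_rfl⟩)).toMeasure
  measurable' := Measurable.of_discrete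

instance (n : ℕ) : IsMarkovKernel (M.nextKernel n) :=
  ⟨fun _ => PMF.toMeasure.isProbabilityMeasure _⟩

/-- The law of the infinite random path started at `s`. -/
def pathMeasure (s : S) : Measure (ℕ → S) :=
  Kernel.traj (X := fun _ => S) M.nextKernel 0 (fun _ => s)

/-- `Pr_s(F A)`: the probability that the path started at `s` reaches `A`. -/
def reachProb (s : S) (A : Set S) : ℝ := (M.pathMeasure s).real {σ | ∃ i, σ i ∈ A}

/-- `Pr_s(XF A)`: the probability that the path started at `s` visits `A` at a positive time. -/
def visitProb (s : S) (A : Set S) : ℝ := (M.pathMeasure s).real {σ | ∃ i, 0 < i ∧ σ i ∈ A}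

def IsRecurrent (s : S) : Prop := M.visitProb s {s} = 1

def IsTransient (s : S) : Prop := ¬ M.IsRecurrent s

end

end MarkovChain

/-- Computability of a function with non-negative real values: some computable function gives,
on input `(s, k)`, the numerator of a dyadic approximation of `f s` within `2⁻ᵏ`. -/
def ComputableNNReal {S : Type*} [Primcodable S] (f : S → ℝ≥0) : Prop :=
  ∃ g : S → ℕ → ℕ, Computable₂ g ∧ ∀ s k, |(f s : ℝ) - (g s k : ℝ) / 2 ^ k| ≤ 1 / 2 ^ k

/-- Divergence of a Markov chain with respect to an initial state `s₀` and a target set `A`. -/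
def MarkovChain.Divergent {S : Type*} [Primcodable S] [MeasurableSpace S]
    [DiscreteMeasurableSpace S] (M : MarkovChain S) (s₀ : S) (A : Set S) : Prop :=
  ∃ f₀ f₁ : S → ℝ≥0, ComputableNNReal f₀ ∧ ComputableNNReal f₁ ∧
    (∀ θ : ℝ, 0 < θ → θ < 1 → M.reachProb s₀ {s | (f₀ s : ℝ) ≤ θ} ≤ θ) ∧
    (∀ s, M.reachProb s A ≤ f₁ s) ∧
    (∀ θ : ℝ, 0 < θ → θ < 1 →
      ({s | θ ≤ (f₀ s : ℝ) ∧ θ ≤ (f₁ s : ℝ)} ∩ M.postStar s₀).Finite)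

/-! ### Polynomial random walks -/

/-- A polynomial random walk on `ℕ`: the weights of the steps `n → n + 1` and `n → n - 1` are
polynomials in `n` with coefficients in `ℕ` and positive constant coefficient. -/
structure PolyWalk where
  up : ℕ[X]
  down : ℕ[X]
  up_pos : 0 < up.coeff 0
  down_pos : 0 < down.coeff 0

namespace PolyWalk

noncomputable section

variable (R : PolyWalk)

/-- The weight `W(n, n + 1)`. -/
def wUp (n : ℕ) : ℕ := R.up.eval n

/-- The weight `W(n, n - 1)`, for `n > 0`. -/
def wDown (n : ℕ) : ℕ := R.down.eval n

theorem wUp_pos (n : ℕ) : 0 < R.wUp n := by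
  have h := R.up_pos
  rw [wUp, Polynomial.eval_eq_sum_range, Finset.sum_range_succ']
  simp only [pow_zero, mul_one]
  omega

/-- Transition probabilities: from `0` one goes to `1`; from `n > 0` one goes to `n + 1` or to
`n - 1` with probabilities proportional to the weights at `n`. -/
def prob (n m : ℕ) : ℝ≥0 :=
  if n = 0 then (if m = 1 then 1 else 0)
  else if m = n + 1 then (R.wUp n : ℝ≥0) / ((R.wUp n : ℝ≥0) + (R.wDown n : ℝ≥0))
  else if m + 1 = n then (R.wDown n : ℝ≥0) / ((R.wUp n : ℝ≥0) + (R.wDown n : ℝ≥0))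
  else 0

theorem hasSum_prob (n : ℕ) : HasSum (R.prob n) 1 := by
  rcases n with _ | n
  · have : R.prob 0 = fun m => if m = 1 then 1 else 0 := by
      funext m; simp [prob]
    rw [this]
    exact hasSum_ite_eq 1 1
  · have hu : (R.wUp (n + 1) : ℝ≥0) ≠ 0 := by
      exact_mod_cast (R.wUp_pos (n + 1)).ne'
    have h := hasSum_sum_of_ne_finset_zero (L := SummationFilter.unconditional ℕ) (f := R.prob (n + 1)) (s := {n + 2, n}) (by
      intro m hm
      simp only [Finset.mem_insert, Finset.mem_singleton, not_or] at hm
      simp only [prob]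
      rw [if_neg (by omega), if_neg (by omega), if_neg (by omega)])
    have hsum : ∑ b ∈ ({n + 2, n} : Finset ℕ), R.prob (n + 1) b = 1 := by
      rw [Finset.sum_pair (by omega)]
      have h1 : n ≠ n + 1 + 1 := by omega
      simp only [prob, Nat.succ_ne_zero, if_false, if_true, if_neg h1, ← add_div]
      exact div_self (fun h0 => hu (add_eq_zero.1 h0).1)
    rwa [hsum] at h

def chain : MarkovChain ℕ := ⟨R.prob, R.hasSum_prob⟩

/-- `ρ n = W(n, n - 1) / W(n, n + 1)`. -/
def ratio (n : ℕ) : ℝ := (R.wDown n : ℝ) / (R.wUp n : ℝ)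

/-- `i` is the greatest index at which the two weight polynomials differ. -/
def TopDiff (i : ℕ) : Prop := IsGreatest {j | R.down.coeff j ≠ R.up.coeff j} i

/-- The quotient of the drift of the second coefficients by the leading coefficient,
`α = (a'_{d-1} - a_{d-1}) / a_d`, where `a` are the coefficients of the downward weight, `a'` those
of the upward weight and `d` is the degree of the former. It is used for `d ≥ 1` only. -/
def drift : ℝ :=
  ((R.up.coeff (R.down.natDegree - 1) : ℝ) - (R.down.coeff (R.down.natDegree - 1) : ℝ)) /
    (R.down.coeff R.down.natDegree : ℝ)

/-- The recurrent cases of the analysis of degrees and coefficients. -/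
def RecurrentCase : Prop :=
  R.up.natDegree < R.down.natDegree ∨
  (R.up.natDegree = R.down.natDegree ∧
    ∃ i, R.TopDiff i ∧ R.up.coeff i < R.down.coeff i) ∨
  R.up = R.down ∨
  (R.up.natDegree = R.down.natDegree ∧
    ∃ i, R.TopDiff i ∧ R.down.coeff i < R.up.coeff i ∧ i + 2 ≤ R.down.natDegree) ∨
  (R.up.natDegree = R.down.natDegree ∧
    ∃ i, R.TopDiff i ∧ i + 1 = R.down.natDegree ∧ 0 < R.drift ∧ R.drift ≤ 1)

/-- The transient case where the hitting probabilities decay polynomially. -/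
def PowerCase : Prop :=
  R.up.natDegree = R.down.natDegree ∧
    ∃ i, R.TopDiff i ∧ i + 1 = R.down.natDegree ∧ 1 < R.drift

/-- The transient case where the hitting probabilities decay geometrically. -/
def GeometricCase : Prop :=
  (R.up.natDegree = R.down.natDegree ∧
    R.down.coeff R.down.natDegree < R.up.coeff R.down.natDegree) ∨
  R.down.natDegree < R.up.natDegree

end

end PolyWalk

/-! ### The divergence problem and its encoding -/

/-- An instance of the divergence problem: a polynomial random walk, an initial state, and a finite
or cofinite target set, given by a finite list of states and, possibly, the least element of
an upward closed set. -/
structure DivInstance where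
  walk : PolyWalk
  init : ℕ
  states : List ℕ
  ray : Option ℕ

namespace DivInstance

def target (x : DivInstance) : Set ℕ := {n | n ∈ x.states ∨ ∃ k ∈ x.ray, k ≤ n}

open Computability (Γ')

/-- A number in binary (least significant bit first), followed by a comma. -/
def encodeNumber (n : ℕ) : List Γ' := (Nat.bits n).map Γ'.bit ++ [Γ'.comma]

/-- A list of numbers, between brackets. -/
def encodeNumbers (l : List ℕ) : List Γ' := Γ'.bra :: (l.flatMap encodeNumber ++ [Γ'.ket])

/-- The coefficients of a polynomial, from the leading one down to the constant one. -/
def coeffList (P : ℕ[X]) : List ℕ := ((List.range (P.natDegree + 1)).map P.coeff).reverse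

/-- The word that encodes an instance. -/
def encode (x : DivInstance) : List Γ' :=
  encodeNumber x.init ++ encodeNumbers x.states ++ encodeNumbers x.ray.toList ++
    encodeNumbers (coeffList x.walk.down) ++ encodeNumbers (coeffList x.walk.up)

end DivInstance

/-- The problem `P`, with instances encoded as words by `enc`, is decidable in linear time by
a machine with finite control and finitely many stacks (that is, by a multitape Turing machine):
on each instance the machine halts with the answer after at most `c * (length of the word + 1)`
steps. -/
def LinearTimeDecidable {α Γ : Type} (enc : α → List Γ) (P : α → Prop) : Prop :=
  ∃ f : α → Bool, (∀ x, f x = true ↔ P x) ∧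
    ∃ (M : Turing.TM2ComputableInTime enc Computability.encodeBool f) (c : ℕ),
      ∀ n, M.time n ≤ c * (n + 1)

/-! Fix `t` and let h(n) be the probability of reaching `t` from n. Conditioning on the first step
gives h(n) - h(n+1) = ρ_n (h(n-1) - h(n)) for n > 0, n ≠ t (`reachProb_diff`). The differences
vanish below `t`, because 0 is left upwards with certainty. Above `t` they are (1 - h(t+1)) P_j with
P_j = ρ_{t+1}⋯ρ_{t+j} (`reachProb_diff_eq`). Since h ≥ 0, the number (1 - h(t+1)) Σ P_j is at most
1, so h = 1 everywhere if Σ P_j diverges. If the sum is a finite S, the normalised tails of the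
series form a non-negative function, harmonic above `t` and equal to 1 at `t`. As h is the least
such function (`reachProb_le_of_superharmonic`), 1 - h(t+1) = 1/S (`reachProb_eq_tail_div`). Thus
recurrence of any state is divergence of this one series.

Whether it converges is read off the leading coefficients. If eventually ρ_n ≥ (n-c-1)/(n-c), the
products telescope to a shifted harmonic series, which diverges; the shift c settles the borderline
drift 1. If ρ_n ≤ 1 - β/n with β > 1, then P_j is of order at most j^(-β), and if ρ_n ≤ α < 1, the
decay is geometric. The cases are exhaustive (`cases`), so these implications are equivalences.

For a transient walk and a finite target, f₀ = 1 and f₁(n) = K / (log₂ n + 1) witness divergence: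
the true decay beats every inverse logarithm, and f₁ is visibly computable. Conversely, suppose that
the target is reached surely from all large states, as for a recurrent walk or a cofinite target.
Then f₁ ≥ 1 there, so f₀ ≤ 1/2 at some large state. The walk reaches that state surely from s₀,
which contradicts (i) at θ = 1/2 (`not_divergent_of_eventually`).

Divergence is therefore a condition on the input word: there is no ray, and either the list of
states is empty, or the upward list of coefficients is longer, or the lists are equally long and a_d
< a'_d, or also a_d = a'_d and a_d + a_{d-1} < a'_{d-1} (`divergent_iff`, `drifts_iff`). A stack
machine tests this in one pass, comparing binary numbers from the least significant digit with
bounded carries. A potential that drops at every step bounds the running time. -/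

namespace MarkovChain

/-! ### Measurability of events on path space. -/

section PathEvents

variable {S : Type*} [MeasurableSpace S]

/-- The path that starts at `s` and goes on as `σ`. -/
def pathCons (s : S) (σ : ℕ → S) : ℕ → S
  | 0 => s
  | n + 1 => σ n

theorem measurable_pathCons (s : S) : Measurable (pathCons s) := by
  refine measurable_pi_lambda _ fun i => ?_
  cases i with
  | zero => exact measurable_const
  | succ n => exact measurable_pi_apply n

variable [DiscreteMeasurableSpace S]

theorem measurableSet_coord (i : ℕ) (A : Set S) : MeasurableSet {σ : ℕ → S | σ i ∈ A} :=
  (measurable_pi_apply i) (MeasurableSet.of_discrete (s := A))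

theorem measurableSet_reach (A : Set S) : MeasurableSet {σ : ℕ → S | ∃ i, σ i ∈ A} := by
  simp only [Set.ofPred_exists]
  exact MeasurableSet.iUnion fun i => measurableSet_coord i A

theorem measurableSet_visit (A : Set S) : MeasurableSet {σ : ℕ → S | ∃ i, 0 < i ∧ σ i ∈ A} := by
  simp only [Set.ofPred_exists, Set.ofPred_and]
  exact MeasurableSet.iUnion fun i => (MeasurableSet.const _).inter (measurableSet_coord i A)

theorem measurableSet_reachWithin (n : ℕ) (A : Set S) :
    MeasurableSet {σ : ℕ → S | ∃ i ≤ n, σ i ∈ A} := by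
  simp only [Set.ofPred_exists, Set.ofPred_and]
  exact MeasurableSet.iUnion fun i => (MeasurableSet.const _).inter (measurableSet_coord i A)

end PathEvents

/-! ### The law of the path, the Markov property and first-step analysis. -/

section PathMeasure

variable {S : Type*} [Countable S] [MeasurableSpace S] [DiscreteMeasurableSpace S]

/-- The paths that agree with `x` up to time `n`. -/
def pathCylinder (n : ℕ) (x : ℕ → S) : Set (ℕ → S) := {σ | ∀ i ≤ n, σ i = x i}

theorem measurableSet_pathCylinder (n : ℕ) (x : ℕ → S) : MeasurableSet (pathCylinder n x) := by
  simp only [pathCylinder, Set.ofPred_forall]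
  exact MeasurableSet.iInter fun i => MeasurableSet.iInter fun _ =>
    measurableSet_eq_fun (measurable_pi_apply i) measurable_const

/-- `S` is countable, so cylinders give the point masses of the marginals on initial segments of
time, and these marginals determine the projective limit. -/
theorem measure_ext_pathCylinder {μ ν : Measure (ℕ → S)} [IsFiniteMeasure μ] [IsFiniteMeasure ν]
    (h : ∀ n x, μ (pathCylinder n x) = ν (pathCylinder n x)) : μ = ν := by
  have hfin : ∀ I : Finset ℕ, IsFiniteMeasure (μ.map (Finset.restrict (π := fun _ => S) I)) :=
    fun I => inferInstance
  have hproj : IsProjectiveMeasureFamily (α := fun _ => S) fun I : Finset ℕ => μ.map (Finset.restrict (π := fun _ => S) I) := by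
    intro I J hJI
    rw [Measure.map_map (by fun_prop) (by fun_prop)]
    rfl
  refine IsProjectiveLimit.unique (P := fun I : Finset ℕ => μ.map (Finset.restrict (π := fun _ => S) I))
    (fun I => rfl) ?_
  rw [isProjectiveLimit_nat_iff hproj]
  intro n
  refine Measure.ext_of_singleton fun y => ?_
  -- The values after time `n` do not affect the cylinder.
  let x : ℕ → S := fun i => if hi : i ≤ n then y ⟨i, Finset.mem_Iic.2 hi⟩ else
    y ⟨0, Finset.mem_Iic.2 n.zero_le⟩
  have hpre : (Preorder.frestrictLe (π := fun _ => S) n) ⁻¹' {y} = pathCylinder n x := by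
    ext σ
    simp only [Set.mem_preimage, Set.mem_singleton_iff, pathCylinder, Set.mem_ofPred_eq, funext_iff]
    constructor
    · intro hσ i hi
      simpa [x, hi] using hσ ⟨i, Finset.mem_Iic.2 hi⟩
    · rintro hσ ⟨i, hi⟩
      have hi' := Finset.mem_Iic.1 hi
      simpa [x, hi'] using hσ i hi'
  rw [Measure.map_apply (by fun_prop) (MeasurableSet.singleton y), hpre]
  have : (μ.map (Finset.restrict (π := fun _ => S) (Finset.Iic n))) {y} = μ (pathCylinder n x) := by
    rw [← hpre]
    exact Measure.map_apply (by fun_prop) (MeasurableSet.singleton y)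
  rw [this, h]

variable (M : MarkovChain S)

instance (s : S) : IsProbabilityMeasure (M.pathMeasure s) := by
  unfold pathMeasure; infer_instance

theorem pathMeasure_cylinder_zero (s : S) (x : ℕ → S) :
    M.pathMeasure s (pathCylinder 0 x) = ({x 0} : Set S).indicator 1 s := by
  have h := Kernel.traj_map_frestrictLe_apply (X := fun _ => S) (κ := M.nextKernel) 0 0 (fun _ => s)
  have hcyl : pathCylinder 0 x =
      (Preorder.frestrictLe (π := fun _ => S) 0) ⁻¹' {y | y ⟨0, Finset.mem_Iic.2 le_rfl⟩ = x 0} := by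
    ext σ
    simp [pathCylinder]
  have hm : MeasurableSet
      {y : Finset.Iic 0 → S | y ⟨0, Finset.mem_Iic.2 le_rfl⟩ = x 0} := MeasurableSet.of_discrete
  rw [pathMeasure, hcyl, ← Measure.map_apply (by fun_prop) hm, h, Kernel.partialTraj_self,
    Kernel.id_apply, Measure.dirac_apply' _ hm]
  rfl

theorem pathMeasure_cylinder_succ (s : S) (n : ℕ) (x : ℕ → S) :
    M.pathMeasure s (pathCylinder (n + 1) x) =
      M.pathMeasure s (pathCylinder n x) * M.p (x n) (x (n + 1)) := by
  have h := Kernel.partialTraj_compProd_eq_map_traj (X := fun _ => S) (κ := M.nextKernel)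
    (Nat.zero_le n) (x₀ := fun _ => s)
  let y : Finset.Iic n → S := fun i => x i
  have h1 : pathCylinder (n + 1) x =
      (fun σ : ℕ → S => (Preorder.frestrictLe (π := fun _ => S) n σ, σ (n + 1))) ⁻¹'
        ({y} ×ˢ {x (n + 1)}) := by
    ext σ
    simp only [pathCylinder, Set.mem_ofPred_eq, Set.mem_preimage, Set.mem_prod,
      Set.mem_singleton_iff, funext_iff]
    constructor
    · exact fun hσ => ⟨fun i => hσ i (by have := Finset.mem_Iic.1 i.2; omega), hσ _ le_rfl⟩
    · rintro ⟨h2, h3⟩ i hi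
      rcases Nat.lt_or_ge n i with hi' | hi'
      · obtain rfl : i = n + 1 := by omega
        exact h3
      · exact h2 ⟨i, Finset.mem_Iic.2 hi'⟩
  have h2 : pathCylinder n x = (Preorder.frestrictLe (π := fun _ => S) n) ⁻¹' {y} := by
    ext σ
    simp only [pathCylinder, Set.mem_ofPred_eq, Set.mem_preimage,
      Set.mem_singleton_iff, funext_iff]
    exact ⟨fun hσ i => hσ i (Finset.mem_Iic.1 i.2), fun hσ i hi => hσ ⟨i, Finset.mem_Iic.2 hi⟩⟩
  have hs : MeasurableSet ({y} ×ˢ {x (n + 1)} : Set ((Finset.Iic n → S) × S)) :=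
    (MeasurableSet.singleton _).prod (MeasurableSet.singleton _)
  rw [pathMeasure, h1, h2, ← Measure.map_apply (by fun_prop) hs, ← h,
    Measure.compProd_apply_prod (MeasurableSet.singleton _) (MeasurableSet.singleton _),
    lintegral_singleton, ← Measure.map_apply (by fun_prop) (MeasurableSet.singleton _),
    Kernel.traj_map_frestrictLe_apply, mul_comm]
  congr 1
  exact PMF.toMeasure_apply_singleton _ _ (MeasurableSet.singleton _)

theorem pathMeasure_cylinder (s : S) (n : ℕ) (x : ℕ → S) :
    M.pathMeasure s (pathCylinder n x) =
      ({x 0} : Set S).indicator 1 s * ∏ i ∈ Finset.range n, (M.p (x i) (x (i + 1)) : ℝ≥0∞) := by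
  induction n with
  | zero => simp [pathMeasure_cylinder_zero]
  | succ n ih => rw [pathMeasure_cylinder_succ, ih, Finset.prod_range_succ, mul_assoc]

/-- The Markov property at time one. -/
theorem pathMeasure_apply_eq_tsum (s : S) {B : Set (ℕ → S)} (hB : MeasurableSet B) :
    M.pathMeasure s B = ∑' s', (M.p s s' : ℝ≥0∞) * M.pathMeasure s' (pathCons s ⁻¹' B) := by
  -- The candidate law draws the first step, runs the chain from there and prepends `s`. It suffices
  -- to compare it with the path law on cylinders.
  set ν : Measure (ℕ → S) :=
    Measure.sum fun s' => (M.p s s' : ℝ≥0∞) • (M.pathMeasure s').map (pathCons s) with hν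
  have hνB : ∀ B, MeasurableSet B →
      ν B = ∑' s', (M.p s s' : ℝ≥0∞) * M.pathMeasure s' (pathCons s ⁻¹' B) := by
    intro B hB
    rw [hν, Measure.sum_apply _ hB]
    simp [Measure.map_apply (measurable_pathCons s) hB]
  have hsum : ∑' s', (M.p s s' : ℝ≥0∞) = 1 :=
    (by simpa using ENNReal.hasSum_coe.2 (M.hasSum_p s) : HasSum _ (1 : ℝ≥0∞)).tsum_eq
  have hfin : IsFiniteMeasure ν := ⟨by
    rw [hνB _ MeasurableSet.univ]
    simp [hsum]⟩
  have hcons0 : ∀ x : ℕ → S, x 0 ≠ s → ∀ n, pathCons s ⁻¹' pathCylinder n x = ∅ := by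
    intro x hx n
    ext σ
    simp only [Set.mem_preimage, pathCylinder, Set.mem_ofPred_eq, Set.mem_empty_iff_false, iff_false]
    exact fun h => hx (h 0 n.zero_le).symm
  have hind : ∀ x : ℕ → S, x 0 ≠ s → ({x 0} : Set S).indicator (1 : S → ℝ≥0∞) s = 0 :=
    fun x hx => Set.indicator_of_notMem (by simpa using hx.symm) _
  have heq : M.pathMeasure s = ν := by
    refine measure_ext_pathCylinder fun n x => ?_
    rw [hνB _ (measurableSet_pathCylinder n x), pathMeasure_cylinder]
    by_cases hx : x 0 = s
    · rw [hx, Set.indicator_of_mem (Set.mem_singleton s), Pi.one_apply, one_mul]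
      cases n with
      | zero =>
        have : pathCons s ⁻¹' pathCylinder 0 x = Set.univ := by
          ext σ
          simp [pathCylinder, pathCons, hx]
        simp [this, hsum]
      | succ n =>
        have : pathCons s ⁻¹' pathCylinder (n + 1) x = pathCylinder n (fun i => x (i + 1)) := by
          ext σ
          simp only [Set.mem_preimage, pathCylinder, Set.mem_ofPred_eq]
          constructor
          · exact fun h i hi => h (i + 1) (by omega)
          · rintro h (_ | i) hi
            · exact hx.symm
            · exact h i (by omega)
        rw [this, tsum_eq_single (x 1)]
        · rw [pathMeasure_cylinder, Finset.prod_range_succ', Set.indicator_of_mem (by simp), hx]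
          simp [mul_comm]
        · intro s' hs'
          rw [pathMeasure_cylinder, Set.indicator_of_notMem (by simpa using hs')]
          simp
    · simp [hind x hx, hcons0 x hx]
  rw [heq, hνB B hB]

theorem pathMeasure_real_eq_tsum (s : S) {B : Set (ℕ → S)} (hB : MeasurableSet B) :
    (M.pathMeasure s).real B =
      ∑' s', (M.p s s' : ℝ) * (M.pathMeasure s').real (pathCons s ⁻¹' B) := by
  rw [measureReal_def, pathMeasure_apply_eq_tsum M s hB, ENNReal.tsum_toReal_eq]
  · simp [measureReal_def]
  · exact fun s' => ENNReal.mul_ne_top ENNReal.coe_ne_top (measure_ne_top _ _)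

/-- The probability of reaching `A` within `n` steps. -/
noncomputable def reachProbWithin (n : ℕ) (s : S) (A : Set S) : ℝ :=
  (M.pathMeasure s).real {σ | ∃ i ≤ n, σ i ∈ A}

theorem pathMeasure_start (s : S) : M.pathMeasure s {σ | σ 0 = s} = 1 := by
  have := M.pathMeasure_cylinder_zero s (fun _ => s)
  simpa [pathCylinder] using this

theorem pathMeasure_start_ae (s : S) : ∀ᵐ σ ∂M.pathMeasure s, σ 0 = s := by
  rw [ae_iff_prob_eq_one]
  · exact pathMeasure_start M s
  · exact (measurableSet_coord 0 {s}).mem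

theorem reachProb_nonneg (s : S) (A : Set S) : 0 ≤ M.reachProb s A := measureReal_nonneg

theorem reachProb_le_one (s : S) (A : Set S) : M.reachProb s A ≤ 1 := measureReal_le_one

theorem reachProb_mono (s : S) {A B : Set S} (h : A ⊆ B) : M.reachProb s A ≤ M.reachProb s B :=
  measureReal_mono fun _ ⟨i, hi⟩ => ⟨i, h hi⟩

theorem reachProb_empty (s : S) : M.reachProb s ∅ = 0 := by simp [reachProb]

theorem reachProb_union_le (s : S) (A B : Set S) :
    M.reachProb s (A ∪ B) ≤ M.reachProb s A + M.reachProb s B := by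
  refine (measureReal_mono ?_).trans (measureReal_union_le _ _)
  rintro σ ⟨i, hi | hi⟩
  exacts [Or.inl ⟨i, hi⟩, Or.inr ⟨i, hi⟩]

theorem reachProb_of_mem {s : S} {A : Set S} (h : s ∈ A) : M.reachProb s A = 1 := by
  refine le_antisymm (M.reachProb_le_one s A) ?_
  have h1 : (M.pathMeasure s).real {σ | σ 0 = s} = 1 := by
    rw [measureReal_def, pathMeasure_start]; rfl
  rw [← h1]
  exact measureReal_mono fun σ hσ => ⟨0, by
    have h0 : σ 0 = s := hσ
    rwa [h0]⟩

theorem reachProb_of_notMem {s : S} {A : Set S} (h : s ∉ A) :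
    M.reachProb s A = ∑' s', (M.p s s' : ℝ) * M.reachProb s' A := by
  rw [reachProb, pathMeasure_real_eq_tsum M s (measurableSet_reach A)]
  refine tsum_congr fun s' => ?_
  congr 2
  ext σ
  simp only [Set.mem_preimage, Set.mem_ofPred_eq]
  constructor
  · rintro ⟨_ | i, hi⟩
    · exact absurd hi h
    · exact ⟨i, hi⟩
  · rintro ⟨i, hi⟩
    exact ⟨i + 1, hi⟩

theorem visitProb_eq_tsum (s : S) (A : Set S) :
    M.visitProb s A = ∑' s', (M.p s s' : ℝ) * M.reachProb s' A := by
  rw [visitProb, pathMeasure_real_eq_tsum M s (measurableSet_visit A)]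
  refine tsum_congr fun s' => ?_
  congr 2
  ext σ
  simp only [Set.mem_preimage, Set.mem_ofPred_eq]
  constructor
  · rintro ⟨_ | i, hpos, hi⟩
    · exact absurd hpos (lt_irrefl _)
    · exact ⟨i, hi⟩
  · rintro ⟨i, hi⟩
    exact ⟨i + 1, i.succ_pos, hi⟩

theorem reachProbWithin_zero_of_notMem {s : S} {A : Set S} (h : s ∉ A) :
    M.reachProbWithin 0 s A = 0 := by
  have h0 : M.pathMeasure s {σ | ¬ σ 0 = s} = 0 := ae_iff.1 (pathMeasure_start_ae M s)
  rw [reachProbWithin, measureReal_def, measure_mono_null ?_ h0]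
  · rfl
  · rintro σ ⟨i, hi, hA⟩ h0
    obtain rfl : i = 0 := by omega
    exact h (h0 ▸ hA)

theorem reachProbWithin_succ_of_notMem (n : ℕ) {s : S} {A : Set S} (h : s ∉ A) :
    M.reachProbWithin (n + 1) s A = ∑' s', (M.p s s' : ℝ) * M.reachProbWithin n s' A := by
  rw [reachProbWithin, pathMeasure_real_eq_tsum M s (measurableSet_reachWithin (n + 1) A)]
  refine tsum_congr fun s' => ?_
  congr 2
  ext σ
  simp only [Set.mem_preimage, Set.mem_ofPred_eq]
  constructor
  · rintro ⟨_ | i, hpos, hi⟩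
    · exact absurd hi h
    · exact ⟨i, by omega, hi⟩
  · rintro ⟨i, hin, hi⟩
    exact ⟨i + 1, by omega, hi⟩

/-- Continuity from below. It reduces upper bounds to a finite horizon, where induction on the
number of steps is possible. -/
theorem reachProb_le_of_forall_within {s : S} {A : Set S} {a : ℝ}
    (h : ∀ n, M.reachProbWithin n s A ≤ a) : M.reachProb s A ≤ a := by
  have hU : {σ : ℕ → S | ∃ i, σ i ∈ A} = ⋃ n, {σ | ∃ i ≤ n, σ i ∈ A} := by
    ext σ
    simp only [Set.mem_ofPred_eq, Set.mem_iUnion]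
    exact ⟨fun ⟨i, hi⟩ => ⟨i, i, le_rfl, hi⟩, fun ⟨_, i, _, hi⟩ => ⟨i, hi⟩⟩
  have hmono : Monotone fun n => {σ : ℕ → S | ∃ i ≤ n, σ i ∈ A} :=
    fun m n hmn σ ⟨i, hi, hA⟩ => ⟨i, hi.trans hmn, hA⟩
  have ht := (ENNReal.tendsto_toReal (measure_ne_top (M.pathMeasure s) _)).comp
    (tendsto_measure_iUnion_atTop (μ := M.pathMeasure s) hmono)
  rw [← hU] at ht
  exact le_of_tendsto' ht h

end PathMeasure

end MarkovChain

/-! ### Hitting probabilities of the walk and the series of ratio products. -/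

namespace PolyWalk

section Reach

variable (R : PolyWalk)

theorem wDown_pos (n : ℕ) : 0 < R.wDown n :=
  wUp_pos ⟨R.down, R.up, R.down_pos, R.up_pos⟩ n

theorem ratio_pos (n : ℕ) : 0 < R.ratio n :=
  div_pos (by exact_mod_cast R.wDown_pos n) (by exact_mod_cast R.wUp_pos n)

/-- The probability of the step `n → n + 1`, for `n > 0`. -/
noncomputable def upProb (n : ℕ) : ℝ := R.wUp n / (R.wUp n + R.wDown n)

theorem upProb_pos (n : ℕ) : 0 < R.upProb n := by
  have h1 := R.wUp_pos n
  have h2 := R.wDown_pos n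
  unfold upProb
  positivity

theorem upProb_lt_one (n : ℕ) : R.upProb n < 1 := by
  have h1 : (0 : ℝ) < R.wUp n := by exact_mod_cast R.wUp_pos n
  have h2 : (0 : ℝ) < R.wDown n := by exact_mod_cast R.wDown_pos n
  rw [upProb, div_lt_one (by positivity)]
  linarith

theorem one_sub_upProb (n : ℕ) : 1 - R.upProb n = R.ratio n * R.upProb n := by
  have h1 : (0 : ℝ) < R.wUp n := by exact_mod_cast R.wUp_pos n
  have h2 : (0 : ℝ) < R.wDown n := by exact_mod_cast R.wDown_pos n
  unfold ratio upProb
  field_simp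
  ring

theorem tsum_step_zero (g : ℕ → ℝ) : ∑' m, (R.chain.p 0 m : ℝ) * g m = g 1 := by
  rw [tsum_eq_single 1]
  · simp [chain, prob]
  · intro m hm
    simp [chain, prob, hm]

theorem tsum_step_succ (n : ℕ) (g : ℕ → ℝ) :
    ∑' m, (R.chain.p (n + 1) m : ℝ) * g m =
      R.upProb (n + 1) * g (n + 2) + (1 - R.upProb (n + 1)) * g n := by
  have h1 : (0 : ℝ) < R.wUp (n + 1) := by exact_mod_cast R.wUp_pos _
  have h2 : (0 : ℝ) < R.wDown (n + 1) := by exact_mod_cast R.wDown_pos _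
  rw [tsum_eq_sum (s := {n + 2, n})]
  · rw [Finset.sum_pair (by omega)]
    have e1 : (R.chain.p (n + 1) (n + 2) : ℝ) = R.upProb (n + 1) := by
      simp [chain, prob, upProb]
    have e2 : (R.chain.p (n + 1) n : ℝ) = 1 - R.upProb (n + 1) := by
      have : n ≠ n + 1 + 1 := by omega
      simp only [chain, prob, upProb, if_neg this, Nat.succ_ne_zero, if_false, if_true]
      push_cast
      field_simp
      ring
    rw [e1, e2]
  · intro m hm
    simp only [Finset.mem_insert, Finset.mem_singleton, not_or] at hm
    have : R.chain.p (n + 1) m = 0 := by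
      simp only [chain, prob]
      rw [if_neg (by omega), if_neg (by omega), if_neg (by omega)]
    simp [this]

theorem step_up (n : ℕ) : R.chain.Step n (n + 1) := by
  have h1 := R.wUp_pos n
  unfold MarkovChain.Step
  simp only [chain, prob]
  split_ifs
  · exact one_pos
  · simp_all
  · positivity

theorem step_down (n : ℕ) : R.chain.Step (n + 1) n := by
  have h1 := R.wDown_pos (n + 1)
  have : n ≠ n + 1 + 1 := by omega
  unfold MarkovChain.Step
  simp only [chain, prob, if_neg this, Nat.succ_ne_zero, if_false, if_true]
  positivity

theorem irreducible : R.chain.Irreducible := by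
  have h1 : ∀ n, R.chain.postStar n 0 := by
    intro n
    induction n with
    | zero => exact Relation.ReflTransGen.refl
    | succ n ih => exact Relation.ReflTransGen.head (R.step_down n) ih
  have h2 : ∀ n, R.chain.postStar 0 n := by
    intro n
    induction n with
    | zero => exact Relation.ReflTransGen.refl
    | succ n ih => exact Relation.ReflTransGen.tail ih (R.step_up n)
  exact fun s s' => Relation.ReflTransGen.trans (h1 s) (h2 s')

theorem postStar_eq_univ (s : ℕ) : R.chain.postStar s = Set.univ :=
  Set.eq_univ_of_forall (R.irreducible s)

theorem reachProb_self (t : ℕ) : R.chain.reachProb t {t} = 1 :=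
  MarkovChain.reachProb_of_mem _ (Set.mem_singleton t)

/-- Harmonicity p h(n+2) + (1 - p) h(n) = h(n+1), with 1 - p = ρ p, rearranged into a recursion for
the differences and divided by p. -/
theorem reachProb_diff {n t : ℕ} (h : n + 1 ≠ t) :
    R.chain.reachProb (n + 1) {t} - R.chain.reachProb (n + 2) {t} =
      R.ratio (n + 1) * (R.chain.reachProb n {t} - R.chain.reachProb (n + 1) {t}) := by
  have h1 := R.chain.reachProb_of_notMem (s := n + 1) (A := {t}) (by simpa using h)
  rw [tsum_step_succ] at h1
  have h2 := R.one_sub_upProb (n + 1)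
  have h3 := R.upProb_pos (n + 1)
  refine mul_left_cancel₀ h3.ne' ?_
  linear_combination (-R.chain.reachProb n {t} + R.chain.reachProb (n + 1) {t}) * -h2 + h1

/-- A walk that has to go up to reach `t` reaches it almost surely. -/
theorem reachProb_of_le {n t : ℕ} (h : n ≤ t) : R.chain.reachProb n {t} = 1 := by
  -- The forced step from 0 makes the first difference vanish, and the recursion carries this up to
  -- `t`.
  have key : ∀ m, m + 1 ≤ t → R.chain.reachProb m {t} = R.chain.reachProb (m + 1) {t} := by
    intro m
    induction m with
    | zero =>
      intro hm
      rw [R.chain.reachProb_of_notMem (by simpa using (by omega : 0 ≠ t)), tsum_step_zero]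
    | succ m ih =>
      intro hm
      have := R.reachProb_diff (n := m) (t := t) (by omega)
      rw [ih (by omega), sub_self, mul_zero] at this
      linarith
  induction h using Nat.decreasingInduction with
  | self => exact R.reachProb_self t
  | of_succ k hk ih => rw [key k hk, ih]

/-- The product `ρ (t + 1) ⋯ ρ (t + j)`. -/
noncomputable def ratioProd (t j : ℕ) : ℝ := ∏ k ∈ Finset.Ioc t (t + j), R.ratio k

theorem ratioProd_zero (t : ℕ) : R.ratioProd t 0 = 1 := by simp [ratioProd]

theorem ratioProd_succ (t j : ℕ) :
    R.ratioProd t (j + 1) = R.ratioProd t j * R.ratio (t + j + 1) := by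
  rw [ratioProd, ratioProd, ← add_assoc, Finset.prod_Ioc_succ_top (by omega)]

theorem ratioProd_pos (t j : ℕ) : 0 < R.ratioProd t j :=
  Finset.prod_pos fun k _ => R.ratio_pos k

theorem ratioProd_add (t i j : ℕ) :
    R.ratioProd t (i + j) = R.ratioProd t i * R.ratioProd (t + i) j := by
  rw [ratioProd, ratioProd, ratioProd, Finset.prod_Ioc_consecutive _ (by omega) (by omega), add_assoc]

/-- Changing the base point drops finitely many terms and multiplies the others by a positive
constant. Hence one condition governs all states. -/
theorem summable_ratioProd_iff (t : ℕ) : Summable (R.ratioProd t) ↔ Summable (R.ratioProd 0) := by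
  rw [← summable_nat_add_iff (f := R.ratioProd 0) t]
  have : (fun j => R.ratioProd 0 (j + t)) = fun j => R.ratioProd 0 t * R.ratioProd t j := by
    funext j
    rw [add_comm j t, ratioProd_add, zero_add]
  rw [this, summable_mul_left_iff (R.ratioProd_pos 0 t).ne']

theorem reachProb_diff_eq (t j : ℕ) :
    R.chain.reachProb (t + j) {t} - R.chain.reachProb (t + j + 1) {t} =
      R.ratioProd t j * (1 - R.chain.reachProb (t + 1) {t}) := by
  induction j with
  | zero => simp [ratioProd_zero, reachProb_self]
  | succ j ih =>
    rw [← add_assoc, R.reachProb_diff (by omega), ih, ratioProd_succ]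
    ring

theorem reachProb_eq_sub (t j : ℕ) :
    R.chain.reachProb (t + j) {t} =
      1 - (1 - R.chain.reachProb (t + 1) {t}) * ∑ i ∈ Finset.range j, R.ratioProd t i := by
  induction j with
  | zero => simp [reachProb_self]
  | succ j ih =>
    rw [Finset.sum_range_succ]
    linear_combination ih - R.reachProb_diff_eq t j

theorem sum_ratioProd_mul_le (t j : ℕ) :
    (1 - R.chain.reachProb (t + 1) {t}) * ∑ i ∈ Finset.range j, R.ratioProd t i ≤ 1 := by
  have h1 := R.reachProb_eq_sub t j
  have h2 := R.chain.reachProb_nonneg (t + j) {t}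
  linarith

/-- If 1 - h(t+1) were positive, non-negativity of h would bound all partial sums of the series. -/
theorem reachProb_of_not_summable (h : ¬ Summable (R.ratioProd 0)) (n t : ℕ) :
    R.chain.reachProb n {t} = 1 := by
  rcases le_total n t with hn | hn
  · exact R.reachProb_of_le hn
  obtain ⟨j, rfl⟩ := Nat.exists_eq_add_of_le hn
  suffices h1 : R.chain.reachProb (t + 1) {t} = 1 by
    rw [reachProb_eq_sub, h1]; ring
  by_contra hne
  have hlt : 0 < 1 - R.chain.reachProb (t + 1) {t} :=
    sub_pos.2 (lt_of_le_of_ne (R.chain.reachProb_le_one _ _) hne)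
  refine h ((R.summable_ratioProd_iff t).1
    (summable_of_sum_range_le (c := 1 / (1 - R.chain.reachProb (t + 1) {t}))
      (fun i => (R.ratioProd_pos t i).le) fun j => ?_))
  rw [le_div_iff₀ hlt, mul_comm]
  exact R.sum_ratioProd_mul_le t j

/-- Reaching probabilities are dominated by non-negative functions that are superharmonic
above `t`. -/
theorem reachProb_le_of_superharmonic {t : ℕ} {g : ℕ → ℝ} (hg : ∀ n, t ≤ n → 0 ≤ g n)
    (hgt : 1 ≤ g t) (hs : ∀ n, t ≤ n →
      R.upProb (n + 1) * g (n + 2) + (1 - R.upProb (n + 1)) * g n ≤ g (n + 1))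
    {n : ℕ} (hn : t ≤ n) : R.chain.reachProb n {t} ≤ g n := by
  -- Induction on the horizon `k`: above `t`, one step of the walk replaces the bound by its
  -- average, which superharmonicity controls. At `t` itself `1 ≤ g t` suffices.
  refine MarkovChain.reachProb_le_of_forall_within _ fun k => ?_
  have hself : ∀ k, R.chain.reachProbWithin k t {t} ≤ g t :=
    fun k => le_trans measureReal_le_one hgt
  induction k generalizing n with
  | zero =>
    rcases hn.eq_or_lt with rfl | hlt
    · exact hself 0
    · rw [MarkovChain.reachProbWithin_zero_of_notMem _ (by simpa using hlt.ne')]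
      exact hg n hn
  | succ k ih =>
    rcases hn.eq_or_lt with rfl | hlt
    · exact hself _
    · obtain ⟨m, rfl⟩ := Nat.exists_eq_add_of_lt hlt
      rw [MarkovChain.reachProbWithin_succ_of_notMem _ _ (by simp; omega), tsum_step_succ]
      have h1 := R.upProb_pos (t + m + 1)
      have h2 := R.upProb_lt_one (t + m + 1)
      refine le_trans (add_le_add (mul_le_mul_of_nonneg_left (ih (by omega)) h1.le)
        (mul_le_mul_of_nonneg_left (ih (by omega)) (by linarith))) (hs (t + m) (by omega))

theorem tail_eq (t j : ℕ) :
    (fun i => ∏ k ∈ Finset.Ioc t (t + j + i), R.ratio k) = fun i => R.ratioProd t (i + j) := by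
  funext i
  rw [ratioProd, add_assoc, add_comm j i]

theorem one_le_tsum_ratioProd {t : ℕ} (h : Summable (R.ratioProd t)) :
    1 ≤ ∑' j, R.ratioProd t j := by
  rw [← R.ratioProd_zero t]
  exact h.le_tsum 0 fun i _ => (R.ratioProd_pos t i).le

/-- The hitting probabilities of a walk with summable products. -/
theorem reachProb_eq_tail_div (h : Summable (R.ratioProd 0)) (t j : ℕ) :
    R.chain.reachProb (t + j) {t} =
      (∑' i, R.ratioProd t (i + j)) / ∑' i, R.ratioProd t i := by
  have ht : Summable (R.ratioProd t) := (R.summable_ratioProd_iff t).2 h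
  set S := ∑' i, R.ratioProd t i with hS
  have hS1 : 1 ≤ S := R.one_le_tsum_ratioProd ht
  have hSpos : 0 < S := by linarith
  have htail : ∀ j, ∑ i ∈ Finset.range j, R.ratioProd t i + ∑' i, R.ratioProd t (i + j) = S :=
    fun j => ht.sum_add_tsum_nat_add j
  have htail0 : ∀ j, 0 ≤ ∑' i, R.ratioProd t (i + j) :=
    fun j => tsum_nonneg fun i => (R.ratioProd_pos t _).le
  set c := 1 - R.chain.reachProb (t + 1) {t} with hc
  -- Non-negativity of the hitting probabilities gives one inequality for the escape probability
  -- `c`; minimality gives the other.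
  have hle : c ≤ 1 / S := by
    have hlim : Filter.Tendsto (fun j => c * ∑ i ∈ Finset.range j, R.ratioProd t i) Filter.atTop
        (nhds (c * S)) := ht.hasSum.tendsto_sum_nat.const_mul c
    rw [le_div_iff₀ hSpos]
    exact le_of_tendsto' hlim (R.sum_ratioProd_mul_le t)
  have hge : 1 / S ≤ c := by
    -- The normalised tail is harmonic above `t` because consecutive tails differ by one product and
    -- 1 - p = ρ p.
    let g : ℕ → ℝ := fun n => (∑' i, R.ratioProd t (i + (n - t))) / S
    have hbound : R.chain.reachProb (t + 1) {t} ≤ g (t + 1) := by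
      refine R.reachProb_le_of_superharmonic (g := g) (fun n _ => div_nonneg (htail0 _) hSpos.le)
        ?_ ?_ (by omega)
      · simp only [g, Nat.sub_self, add_zero]
        rw [← hS, div_self hSpos.ne']
      · intro n hn
        obtain ⟨m, rfl⟩ := Nat.exists_eq_add_of_le hn
        have e1 : t + m + 2 - t = m + 2 := by omega
        have e2 : t + m + 1 - t = m + 1 := by omega
        have e3 : t + m - t = m := by omega
        simp only [g, e1, e2, e3]
        have a0 := htail m
        have a1 := htail (m + 1)
        have a2 := htail (m + 2)
        rw [Finset.sum_range_succ] at a1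
        rw [Finset.sum_range_succ, Finset.sum_range_succ] at a2
        have hr := R.ratioProd_succ t m
        have hu := R.one_sub_upProb (t + m + 1)
        rw [← mul_div_assoc, ← mul_div_assoc, ← add_div]
        refine div_le_div_of_nonneg_right (le_of_eq ?_) hSpos.le
        have b1 : ∑' i, R.ratioProd t (i + (m + 1)) =
            ∑' i, R.ratioProd t (i + m) - R.ratioProd t m := by linarith
        have b2 : ∑' i, R.ratioProd t (i + (m + 2)) =
            ∑' i, R.ratioProd t (i + m) - R.ratioProd t m - R.ratioProd t (m + 1) := by linarith
        rw [b1, b2, hr]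
        linear_combination R.ratioProd t m * hu
    have h1 : g (t + 1) = (S - 1) / S := by
      have e2 : t + 1 - t = 1 := by omega
      have a1 := htail 1
      rw [Finset.sum_range_one, ratioProd_zero] at a1
      simp only [g, e2]
      rw [← a1]
      ring
    rw [h1, sub_div, div_self hSpos.ne'] at hbound
    rw [hc]
    linarith
  have hcS : c = 1 / S := le_antisymm hle hge
  rw [reachProb_eq_sub, ← hc, hcS, eq_div_iff hSpos.ne']
  have := htail j
  field_simp
  linarith

/-- A first step downwards is followed by a sure return, so only the upward step, which has positive
probability, can prevent recurrence. -/
theorem visitProb_eq_one_iff (s : ℕ) :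
    R.chain.visitProb s {s} = 1 ↔ R.chain.reachProb (s + 1) {s} = 1 := by
  rw [MarkovChain.visitProb_eq_tsum]
  cases s with
  | zero => rw [tsum_step_zero]
  | succ s =>
    rw [tsum_step_succ, R.reachProb_of_le (n := s) (by omega)]
    have h := R.upProb_pos (s + 1)
    constructor
    · intro h1
      refine mul_left_cancel₀ h.ne' ?_
      linarith
    · intro h1
      rw [show s + 2 = s + 1 + 1 from rfl, h1]
      ring

theorem isRecurrent_iff (s : ℕ) : R.chain.IsRecurrent s ↔ ¬ Summable (R.ratioProd 0) := by
  rw [MarkovChain.IsRecurrent, visitProb_eq_one_iff]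
  refine ⟨fun h1 hsum => ?_, fun h => R.reachProb_of_not_summable h _ _⟩
  have hs : Summable (R.ratioProd s) := (R.summable_ratioProd_iff s).2 hsum
  have hpos : 0 < ∑' i, R.ratioProd s i := by linarith [R.one_le_tsum_ratioProd hs]
  rw [R.reachProb_eq_tail_div hsum s 1, div_eq_one_iff_eq hpos.ne'] at h1
  have := hs.sum_add_tsum_nat_add 1
  rw [Finset.sum_range_one, ratioProd_zero, h1] at this
  linarith

theorem isTransient_iff (s : ℕ) : R.chain.IsTransient s ↔ Summable (R.ratioProd 0) := by
  rw [MarkovChain.IsTransient, isRecurrent_iff, not_not]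

end Reach

end PolyWalk

/-! ### Quantitative bounds from bounds on the ratios. -/

namespace PolyWalk

section Estimates

variable (R : PolyWalk)

/-- Every product in the numerator contains ρ_{t+1}⋯ρ_N, which is itself one term of the
denominator. Cancelling it removes the uncontrolled ratios below `N`. -/
theorem reachProb_le_tail (h : Summable (R.ratioProd 0)) {t N n : ℕ} (htN : t ≤ N) (hNn : N ≤ n) :
    R.chain.reachProb n {t} ≤ ∑' i, R.ratioProd N (i + (n - N)) := by
  obtain ⟨a, rfl⟩ := Nat.exists_eq_add_of_le htN
  obtain ⟨b, rfl⟩ := Nat.exists_eq_add_of_le hNn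
  have ht : Summable (R.ratioProd t) := (R.summable_ratioProd_iff t).2 h
  have hpos : 0 < ∑' i, R.ratioProd t i := by linarith [R.one_le_tsum_ratioProd ht]
  rw [add_assoc, R.reachProb_eq_tail_div h, div_le_iff₀ hpos]
  have e : ∀ i, R.ratioProd t (i + (a + b)) = R.ratioProd (t + a) (i + b) * R.ratioProd t a := by
    intro i
    rw [show i + (a + b) = a + (i + b) by omega, ratioProd_add, mul_comm]
  have e2 : t + (a + b) - (t + a) = b := by omega
  simp only [e, e2]
  rw [tsum_mul_right]
  exact mul_le_mul_of_nonneg_left (ht.le_tsum a fun i _ => (R.ratioProd_pos t i).le)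
    (tsum_nonneg fun i => (R.ratioProd_pos _ _).le)

theorem ratioProd_le_pow {α : ℝ} {N : ℕ} (hα : 0 ≤ α) (h : ∀ n, N ≤ n → R.ratio n ≤ α) (j : ℕ) :
    R.ratioProd N j ≤ α ^ j := by
  induction j with
  | zero => simp [ratioProd_zero]
  | succ j ih =>
    rw [ratioProd_succ, pow_succ]
    exact mul_le_mul ih (h _ (by omega)) (R.ratio_pos _).le (pow_nonneg hα j)

theorem summable_of_ratio_le {α : ℝ} {N : ℕ} (hα : 0 ≤ α) (hα1 : α < 1)
    (h : ∀ n, N ≤ n → R.ratio n ≤ α) : Summable (R.ratioProd N) :=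
  Summable.of_nonneg_of_le (fun j => (R.ratioProd_pos N j).le) (R.ratioProd_le_pow hα h)
    (summable_geometric_of_lt_one hα hα1)

theorem reachProb_le_of_ratio_le {α : ℝ} {n₀ t n : ℕ} (hα : 0 ≤ α) (hα1 : α < 1)
    (h : ∀ n, n₀ ≤ n → R.ratio n ≤ α) (hn : max n₀ t ≤ n) :
    R.chain.reachProb n {t} ≤ α ^ (n - max n₀ t) / (1 - α) := by
  set N := max n₀ t with hN
  have hN0 : ∀ n, N ≤ n → R.ratio n ≤ α := fun n hn => h n ((le_max_left _ _).trans hn)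
  have hs : Summable (R.ratioProd N) := R.summable_of_ratio_le hα hα1 hN0
  refine (R.reachProb_le_tail ((R.summable_ratioProd_iff N).1 hs) (le_max_right n₀ t) hn).trans ?_
  rw [div_eq_mul_inv, ← tsum_geometric_of_lt_one hα hα1, ← tsum_mul_left]
  refine Summable.tsum_le_tsum (fun i => ?_) ((summable_nat_add_iff (n - N)).2 hs)
    ((summable_geometric_of_lt_one hα hα1).mul_left _)
  rw [← pow_add, add_comm (n - N)]
  exact R.ratioProd_le_pow hα hN0 _

/-- Combines log(x/(x+1)) ≥ -1/x with e^y ≥ 1 + y. The right-hand side is chosen to telescope in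
products. -/
theorem one_sub_div_le_rpow {β : ℝ} (hβ : 0 ≤ β) {x : ℝ} (hx : 0 < x) :
    1 - β / x ≤ (x / (x + 1)) ^ β := by
  have h1 : 0 < x / (x + 1) := by positivity
  rw [Real.rpow_def_of_pos h1]
  have h2 : -(1 / x) ≤ Real.log (x / (x + 1)) := by
    have := Real.one_sub_inv_le_log_of_pos h1
    have e : 1 - (x / (x + 1))⁻¹ = -(1 / x) := by field_simp; ring
    linarith
  have h3 := Real.add_one_le_exp (Real.log (x / (x + 1)) * β)
  have h4 : -(1 / x) * β ≤ Real.log (x / (x + 1)) * β := mul_le_mul_of_nonneg_right h2 hβ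
  have e : -(1 / x) * β = -(β / x) := by ring
  linarith

/-- The right-hand side is the integral of u^(-β) over [x, x+1], written as a difference that
telescopes in sums. The proof avoids integration by e^y ≥ 1 + y again. -/
theorem rpow_neg_le_sub {β : ℝ} (hβ : 1 < β) {x : ℝ} (hx : 0 < x) :
    (x + 1) ^ (-β) ≤ (x ^ (1 - β) - (x + 1) ^ (1 - β)) / (β - 1) := by
  have hx1 : 0 < x + 1 := by linarith
  rw [le_div_iff₀ (by linarith)]
  have h1 : 0 < x / (x + 1) := by positivity
  have h2 : Real.log (x / (x + 1)) ≤ -(1 / (x + 1)) := by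
    have := Real.log_le_sub_one_of_pos h1
    have e : x / (x + 1) - 1 = -(1 / (x + 1)) := by field_simp; ring
    linarith
  have h3 : 1 + (β - 1) / (x + 1) ≤ (x / (x + 1)) ^ (1 - β) := by
    rw [Real.rpow_def_of_pos h1]
    have h3 := Real.add_one_le_exp (Real.log (x / (x + 1)) * (1 - β))
    have h4 := mul_le_mul_of_nonpos_right h2 (by linarith : 1 - β ≤ 0)
    have e : -(1 / (x + 1)) * (1 - β) = (β - 1) / (x + 1) := by ring
    linarith
  rw [Real.div_rpow hx.le hx1.le, le_div_iff₀ (Real.rpow_pos_of_pos hx1 _)] at h3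
  have e : (x + 1) ^ (1 - β) = (x + 1) ^ (-β) * (x + 1) := by
    rw [← Real.rpow_add_one hx1.ne']
    congr 1
    ring
  rw [e] at h3 ⊢
  have e2 : (1 + (β - 1) / (x + 1)) * ((x + 1) ^ (-β) * (x + 1)) =
      (x + 1) ^ (-β) * (x + 1) + (x + 1) ^ (-β) * (β - 1) := by
    field_simp
  linarith

theorem ratioProd_le_rpow {β : ℝ} {N : ℕ} (hβ : 0 ≤ β)
    (h : ∀ n : ℕ, N ≤ n → R.ratio n ≤ 1 - β / n) (j : ℕ) :
    R.ratioProd N j ≤ ((N + 1 : ℝ) / (N + j + 1)) ^ β := by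
  induction j with
  | zero => simp [ratioProd_zero, div_self (by positivity : (N + 1 : ℝ) ≠ 0)]
  | succ j ih =>
    have h1 : (0 : ℝ) < N + j + 1 := by positivity
    have h2 := h (N + j + 1) (by omega)
    push_cast at h2 ⊢
    have e : (N + 1 : ℝ) / (N + (j + 1) + 1) =
        (N + 1 : ℝ) / (N + j + 1) * ((N + j + 1) / (N + j + 1 + 1)) := by
      field_simp
      ring
    rw [ratioProd_succ, e, Real.mul_rpow (by positivity) (by positivity)]
    exact mul_le_mul ih (h2.trans (one_sub_div_le_rpow hβ h1)) (R.ratio_pos _).le (by positivity)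

theorem sum_ratioProd_le_rpow {β : ℝ} {N j : ℕ} (hβ : 1 < β)
    (h : ∀ n : ℕ, N ≤ n → R.ratio n ≤ 1 - β / n) (hj : 0 < N + j) (k : ℕ) :
    ∑ i ∈ Finset.range k, R.ratioProd N (i + j) ≤
      (N + 1 : ℝ) ^ β / ((β - 1) * ((N + j : ℕ) : ℝ) ^ (β - 1)) := by
  have hb : 0 < β - 1 := by linarith
  have hpos : (0 : ℝ) < ((N + j : ℕ) : ℝ) := by exact_mod_cast hj
  -- The telescoped form keeps the negative end term, which the induction needs and the final bound
  -- drops.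
  have key : ∑ i ∈ Finset.range k, R.ratioProd N (i + j) ≤
      (N + 1 : ℝ) ^ β * ((((N + j : ℕ) : ℝ) ^ (1 - β) - ((N + j + k : ℕ) : ℝ) ^ (1 - β)) / (β - 1)) := by
    induction k with
    | zero => simp
    | succ k ih =>
      rw [Finset.sum_range_succ]
      have hx : (0 : ℝ) < ((N + j + k : ℕ) : ℝ) := by exact_mod_cast (by omega)
      have h1 := rpow_neg_le_sub hβ hx
      have h2 : R.ratioProd N (k + j) ≤ (N + 1 : ℝ) ^ β * (((N + j + k : ℕ) : ℝ) + 1) ^ (-β) := by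
        refine (R.ratioProd_le_rpow (by linarith) h (k + j)).trans (le_of_eq ?_)
        rw [Real.div_rpow (by positivity) (by positivity), Real.rpow_neg (by positivity),
          div_eq_mul_inv]
        congr 3
        push_cast
        ring
      have h3 := mul_le_mul_of_nonneg_left h1 (by positivity : (0 : ℝ) ≤ (N + 1 : ℝ) ^ β)
      have e : ((N + j + (k + 1) : ℕ) : ℝ) = ((N + j + k : ℕ) : ℝ) + 1 := by push_cast; ring
      rw [e]
      calc _ ≤ _ := add_le_add ih (h2.trans h3)
        _ = _ := by ring
  refine key.trans ?_
  rw [← mul_div_assoc, div_le_div_iff₀ hb (by positivity)]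
  have h4 : ((N + j : ℕ) : ℝ) ^ (1 - β) * ((N + j : ℕ) : ℝ) ^ (β - 1) = 1 := by
    rw [← Real.rpow_add hpos]; simp
  have h5 : (0 : ℝ) ≤ ((N + j + k : ℕ) : ℝ) ^ (1 - β) := by positivity
  have h6 : (0 : ℝ) < ((N + j : ℕ) : ℝ) ^ (β - 1) := by positivity
  have h7 : (0 : ℝ) < (N + 1 : ℝ) ^ β := by positivity
  calc _ = (N + 1 : ℝ) ^ β * (β - 1) * (((N + j : ℕ) : ℝ) ^ (1 - β) * ((N + j : ℕ) : ℝ) ^ (β - 1) -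
          ((N + j + k : ℕ) : ℝ) ^ (1 - β) * ((N + j : ℕ) : ℝ) ^ (β - 1)) := by ring
    _ ≤ (N + 1 : ℝ) ^ β * (β - 1) * 1 := by
        refine mul_le_mul_of_nonneg_left ?_ (by positivity)
        rw [h4]
        have := mul_nonneg h5 h6.le
        linarith
    _ = _ := by ring

theorem summable_of_ratio_le_one_sub {β : ℝ} {N : ℕ} (hβ : 1 < β) (hN : 0 < N)
    (h : ∀ n : ℕ, N ≤ n → R.ratio n ≤ 1 - β / n) : Summable (R.ratioProd N) :=
  summable_of_sum_range_le (fun j => (R.ratioProd_pos N j).le)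
    (R.sum_ratioProd_le_rpow (j := 0) hβ h (by omega))

theorem reachProb_le_of_ratio_le_one_sub {β : ℝ} {n₀ t n : ℕ} (hβ : 1 < β) (hn₀ : 1 ≤ n₀)
    (h : ∀ n : ℕ, n₀ ≤ n → R.ratio n ≤ 1 - β / n) (hn : max n₀ t ≤ n) :
    R.chain.reachProb n {t} ≤
      ((max n₀ t : ℕ) + 1 : ℝ) ^ β / ((β - 1) * (n : ℝ) ^ (β - 1)) := by
  set N := max n₀ t with hN
  have hN1 : 0 < N := lt_of_lt_of_le hn₀ (le_max_left _ _)
  have hN0 : ∀ n : ℕ, N ≤ n → R.ratio n ≤ 1 - β / n := fun n hn => h n ((le_max_left _ _).trans hn)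
  have hs : Summable (R.ratioProd N) := R.summable_of_ratio_le_one_sub hβ hN1 hN0
  refine (R.reachProb_le_tail ((R.summable_ratioProd_iff N).1 hs) (le_max_right n₀ t) hn).trans ?_
  refine Real.tsum_le_of_sum_range_le (fun i => (R.ratioProd_pos N _).le) fun k => ?_
  have := R.sum_ratioProd_le_rpow (j := n - N) hβ hN0 (by omega) k
  rwa [Nat.add_sub_cancel' hn] at this

/-- The lower bounds telescope: with N = c + 1 + K the products dominate (K+1)/(K+1+j), a multiple
of a shifted harmonic series. -/
theorem not_summable_of_le_ratio {c N : ℕ} (hN : c + 1 ≤ N)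
    (h : ∀ n : ℕ, N < n → (n - c - 1 : ℝ) / (n - c) ≤ R.ratio n) :
    ¬ Summable (R.ratioProd 0) := by
  rw [← R.summable_ratioProd_iff N]
  obtain ⟨K, rfl⟩ := Nat.exists_eq_add_of_le hN
  have hK : (0 : ℝ) < K + 1 := by positivity
  have key : ∀ j, (K + 1 : ℝ) / (K + 1 + j) ≤ R.ratioProd (c + 1 + K) j := by
    intro j
    induction j with
    | zero => simp [ratioProd_zero, div_self hK.ne']
    | succ j ih =>
      rw [ratioProd_succ]
      have h1 := h (c + 1 + K + j + 1) (by omega)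
      have e : (K + 1 : ℝ) / (K + 1 + (j + 1 : ℕ)) = (K + 1 : ℝ) / (K + 1 + j) *
          ((((c + 1 + K + j + 1 : ℕ) : ℝ) - c - 1) / ((c + 1 + K + j + 1 : ℕ) - c)) := by
        push_cast
        have e1 : (c + 1 + K + j + 1 - c - 1 : ℝ) = K + 1 + j := by ring
        have e2 : (c + 1 + K + j + 1 - c : ℝ) = K + 1 + (j + 1) := by ring
        rw [e1, e2]
        field_simp
      rw [e]
      refine mul_le_mul ih h1 (div_nonneg ?_ ?_) (R.ratioProd_pos _ _).le
      · push_cast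
        have : (0 : ℝ) ≤ K + j + 1 := by positivity
        linarith
      · push_cast
        have : (0 : ℝ) ≤ K + j + 1 := by positivity
        linarith
  intro hs
  have h1 : Summable fun j : ℕ => (K + 1 : ℝ) / (K + 1 + j) :=
    Summable.of_nonneg_of_le (fun j => by positivity) key hs
  have h2 : (fun j : ℕ => (K + 1 : ℝ) / (K + 1 + j)) =
      fun j : ℕ => (K + 1 : ℝ) * (((j + (K + 1) : ℕ) : ℝ)⁻¹) := by
    funext j
    rw [div_eq_mul_inv]
    push_cast
    ring_nf
  rw [h2, summable_mul_left_iff hK.ne'] at h1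
  exact Real.not_summable_natCast_inv
    ((summable_nat_add_iff (f := fun n : ℕ => (n : ℝ)⁻¹) (K + 1)).1 h1)

end Estimates

/-! ### From coefficients to the asymptotics of the ratios. -/

section Cases

open Filter

theorem eventually_eval_pos {p : ℝ[X]} {d : ℕ} (hd : ∀ i, d < i → p.coeff i = 0)
    (h : 0 < p.coeff d) : ∀ᶠ n : ℕ in atTop, 0 < p.eval (n : ℝ) := by
  have hdeg : p.natDegree = d :=
    le_antisymm (natDegree_le_iff_coeff_eq_zero.2 hd) (le_natDegree_of_ne_zero h.ne')
  have hlc : 0 < p.leadingCoeff := by rwa [leadingCoeff, hdeg]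
  refine tendsto_natCast_atTop_atTop.eventually (p := fun x : ℝ => 0 < p.eval x) ?_
  rcases Nat.eq_zero_or_pos d with rfl | hpos
  · rw [eq_C_of_natDegree_eq_zero hdeg]
    exact Eventually.of_forall fun x => by simpa using h
  · exact (tendsto_atTop_of_leadingCoeff_nonneg p
      (natDegree_pos_iff_degree_pos.1 (hdeg ▸ hpos)) hlc.le).eventually_gt_atTop 0

/-- Needed for the borderline drift 1, where the top coefficient may vanish and the next one
decides. -/
theorem eventually_eval_pos_of_succ {p : ℝ[X]} {d : ℕ} (hd : ∀ i, d + 1 < i → p.coeff i = 0)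
    (h1 : 0 ≤ p.coeff (d + 1)) (h : 0 < p.coeff d) : ∀ᶠ n : ℕ in atTop, 0 < p.eval (n : ℝ) := by
  rcases h1.eq_or_lt with h0 | h0
  · refine eventually_eval_pos (d := d) (fun i hi => ?_) h
    rcases (Nat.succ_le_of_lt hi).eq_or_lt with rfl | hi'
    exacts [h0.symm, hd i hi']
  · exact eventually_eval_pos hd h0

variable (R : PolyWalk)

/-- The real polynomial of the upward weights. -/
noncomputable def upPoly : ℝ[X] := R.up.map (Nat.castRingHom ℝ)

/-- The real polynomial of the downward weights. -/
noncomputable def downPoly : ℝ[X] := R.down.map (Nat.castRingHom ℝ)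

theorem coeff_upPoly (i : ℕ) : R.upPoly.coeff i = R.up.coeff i := by simp [upPoly]

theorem coeff_downPoly (i : ℕ) : R.downPoly.coeff i = R.down.coeff i := by simp [downPoly]

theorem eval_upPoly (n : ℕ) : R.upPoly.eval (n : ℝ) = R.wUp n := by
  simp [upPoly, wUp]

theorem eval_downPoly (n : ℕ) : R.downPoly.eval (n : ℝ) = R.wDown n := by
  simp [downPoly, wDown]

theorem up_ne_zero : R.up ≠ 0 := fun h => by
  have := R.up_pos
  simp [h] at this

theorem down_ne_zero : R.down ≠ 0 := fun h => by
  have := R.down_pos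
  simp [h] at this

theorem up_lead_pos : 0 < R.up.coeff R.up.natDegree :=
  Nat.pos_of_ne_zero (by simpa using R.up_ne_zero)

theorem down_lead_pos : 0 < R.down.coeff R.down.natDegree :=
  Nat.pos_of_ne_zero (by simpa using R.down_ne_zero)

variable {R}

theorem TopDiff.coeff_eq {i j : ℕ} (h : R.TopDiff i) (hj : i < j) :
    R.down.coeff j = R.up.coeff j := by
  by_contra hne
  exact absurd (h.2 hne) (not_le.2 hj)

variable (R)

theorem cases : R.RecurrentCase ∨ R.PowerCase ∨ R.GeometricCase := by
  rcases lt_trichotomy R.up.natDegree R.down.natDegree with hlt | heq | hgt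
  · exact Or.inl (Or.inl hlt)
  · by_cases hud : R.up = R.down
    · exact Or.inl (Or.inr (Or.inr (Or.inl hud)))
    obtain ⟨j, hj⟩ : ∃ j, R.down.coeff j ≠ R.up.coeff j := by
      by_contra! hall
      exact hud (Polynomial.ext fun j => (hall j).symm)
    have hle : ∀ j, R.down.coeff j ≠ R.up.coeff j → j ≤ R.down.natDegree := by
      intro j hj
      by_contra! hlt
      rw [coeff_eq_zero_of_natDegree_lt hlt, coeff_eq_zero_of_natDegree_lt (heq ▸ hlt)] at hj
      exact hj rfl
    have hex : ∃ i, R.TopDiff i := by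
      have hfin : {j | R.down.coeff j ≠ R.up.coeff j}.Finite :=
        (Set.finite_Iic R.down.natDegree).subset fun j hj => hle j hj
      obtain ⟨i, hi, hmax⟩ := Set.exists_max_image _ id hfin ⟨j, hj⟩
      exact ⟨i, hi, fun k hk => hmax k hk⟩
    obtain ⟨i, hi⟩ := hex
    rcases lt_or_gt_of_ne (show R.down.coeff i ≠ R.up.coeff i from hi.1) with h | h
    · have hid := hle i hi.1
      rcases Nat.lt_or_ge R.down.natDegree (i + 2) with h2 | h2
      · rcases hid.eq_or_lt with h3 | h3
        · exact Or.inr (Or.inr (Or.inl ⟨heq, h3 ▸ h⟩))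
        · have h4 : i + 1 = R.down.natDegree := by omega
          have hpos : 0 < R.drift := by
            have h5 : (0 : ℝ) < R.down.coeff R.down.natDegree := by
              exact_mod_cast R.down_lead_pos
            have h6 : (R.down.coeff i : ℝ) < R.up.coeff i := by exact_mod_cast h
            rw [drift, ← h4, Nat.add_sub_cancel, h4]
            exact div_pos (by linarith) h5
          rcases le_or_gt R.drift 1 with h1 | h1
          · exact Or.inl (Or.inr (Or.inr (Or.inr (Or.inr ⟨heq, i, hi, h4, hpos, h1⟩))))
          · exact Or.inr (Or.inl ⟨heq, i, hi, h4, h1⟩)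
      · exact Or.inl (Or.inr (Or.inr (Or.inr (Or.inl ⟨heq, i, hi, h, h2⟩))))
    · exact Or.inl (Or.inr (Or.inl ⟨heq, i, hi, h⟩))
  · exact Or.inr (Or.inr (Or.inr hgt))

variable {R}

/-- The hypothesis is ρ_n ≥ (n-c-1)/(n-c) with denominators cleared, hence a sign condition on a
polynomial. -/
theorem not_summable_of_eventually (c : ℕ)
    (h : ∀ᶠ n : ℕ in atTop, (0 : ℝ) ≤ (R.wDown n - R.wUp n) * (n - c) + R.wUp n) :
    ¬ Summable (R.ratioProd 0) := by
  obtain ⟨N, hN⟩ := eventually_atTop.1 h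
  refine R.not_summable_of_le_ratio (c := c) (N := max N (c + 1)) (le_max_right _ _) fun n hn => ?_
  have h1 := hN n ((le_max_left _ _).trans hn.le)
  have h2 : c + 1 < n := lt_of_le_of_lt (le_max_right _ _) hn
  have h3 : (c : ℝ) + 1 < n := by exact_mod_cast h2
  have h4 : (0 : ℝ) < R.wUp n := by exact_mod_cast R.wUp_pos n
  rw [ratio, div_le_div_iff₀ (by linarith) h4]
  linarith

theorem RecurrentCase.not_summable (h : R.RecurrentCase) : ¬ Summable (R.ratioProd 0) := by
  have hge : (∀ᶠ n : ℕ in atTop, (0 : ℝ) ≤ R.wDown n - R.wUp n) → ¬ Summable (R.ratioProd 0) := by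
    intro hev
    refine not_summable_of_eventually 0 ?_
    filter_upwards [hev] with n hn
    have := mul_nonneg hn (Nat.cast_nonneg (α := ℝ) n)
    have h4 : (0 : ℝ) < R.wUp n := by exact_mod_cast R.wUp_pos n
    simpa using add_nonneg this h4.le
  have hsub : (∀ᶠ n : ℕ in atTop, 0 < (R.downPoly - R.upPoly).eval (n : ℝ)) →
      ¬ Summable (R.ratioProd 0) := by
    intro hev
    refine hge ?_
    filter_upwards [hev] with n hn
    rw [eval_sub, eval_downPoly, eval_upPoly] at hn
    exact hn.le
  have hF : ∀ c : ℕ, (∀ᶠ n : ℕ in atTop, 0 < ((R.downPoly - R.upPoly) * X -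
      C (c : ℝ) * (R.downPoly - R.upPoly) + R.upPoly).eval (n : ℝ)) →
      ¬ Summable (R.ratioProd 0) := by
    intro c hev
    refine not_summable_of_eventually c ?_
    filter_upwards [hev] with n hn
    simp only [eval_add, eval_sub, eval_mul, eval_X, eval_C, eval_downPoly, eval_upPoly] at hn
    linarith
  rcases h with h | ⟨hd, i, hi, h⟩ | h | ⟨hd, i, hi, h, hi2⟩ | ⟨hd, i, hi, hi1, h0, h1⟩
  · refine hsub (eventually_eval_pos (d := R.down.natDegree) (fun i hi => ?_) ?_)
    · rw [coeff_sub, coeff_downPoly, coeff_upPoly, coeff_eq_zero_of_natDegree_lt hi,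
        coeff_eq_zero_of_natDegree_lt (h.trans hi), sub_self]
    · rw [coeff_sub, coeff_downPoly, coeff_upPoly, coeff_eq_zero_of_natDegree_lt h]
      have := R.down_lead_pos
      simpa using this
  · refine hsub (eventually_eval_pos (d := i) (fun j hj => ?_) ?_)
    · rw [coeff_sub, coeff_downPoly, coeff_upPoly, hi.coeff_eq hj, sub_self]
    · rw [coeff_sub, coeff_downPoly, coeff_upPoly, sub_pos]
      exact_mod_cast h
  · refine hge (Eventually.of_forall fun n => ?_)
    simp [wUp, wDown, h]
  · obtain ⟨e, he⟩ := Nat.exists_eq_add_of_le hi2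
    have hz : ∀ j, i < j → (R.downPoly - R.upPoly).coeff j = 0 := fun j hj => by
      rw [coeff_sub, coeff_downPoly, coeff_upPoly, hi.coeff_eq hj, sub_self]
    -- The difference of the weights times n has degree at most i + 1 < d, so the leading term of
    -- the upward weight dominates.
    refine hF 0 (eventually_eval_pos (d := i + e + 1 + 1) (fun j hj => ?_) ?_)
    · obtain ⟨k, rfl⟩ : ∃ k, j = k + 1 := ⟨j - 1, by omega⟩
      rw [coeff_add, coeff_sub, coeff_mul_X, coeff_C_mul, hz _ (by omega), hz _ (by omega),
        coeff_upPoly, coeff_eq_zero_of_natDegree_lt (by omega)]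
      simp
    · rw [coeff_add, coeff_sub, coeff_mul_X, coeff_C_mul, hz _ (by omega), hz _ (by omega),
        coeff_upPoly]
      have := R.up_lead_pos
      rw [hd, he, show i + 2 + e = i + e + 1 + 1 by omega] at this
      simpa using this
  · have hz : ∀ j, i < j → (R.downPoly - R.upPoly).coeff j = 0 := fun j hj => by
      rw [coeff_sub, coeff_downPoly, coeff_upPoly, hi.coeff_eq hj, sub_self]
    have hlead : (0 : ℝ) < R.down.coeff (i + 1) := by
      rw [hi1]
      exact_mod_cast R.down_lead_pos
    have hup : R.up.coeff (i + 1) = R.down.coeff (i + 1) := (hi.coeff_eq (by omega)).symm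
    rw [drift, ← hi1, Nat.add_sub_cancel] at h0 h1
    have hδ : (R.down.coeff i : ℝ) < R.up.coeff i := by
      have := (div_pos_iff_of_pos_right hlead).1 h0
      linarith
    have hδ1 : (R.up.coeff i : ℝ) - R.down.coeff i ≤ R.down.coeff (i + 1) := (div_le_one hlead).1 h1
    have hδ2 : (R.down.coeff i : ℝ) + 1 ≤ R.up.coeff i := by
      have : R.down.coeff i < R.up.coeff i := by exact_mod_cast hδ
      exact_mod_cast this
    -- If the drift is 1 the coefficient of n^(i+1) cancels. That of n^i contains c (a'_i - a_i) ≥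
    -- c, which outweighs the only negative contribution, at worst -a'_{i-1}. For i = 0 the
    -- truncated index is harmless.
    set c := R.up.coeff (i - 1) + 1 with hc
    have hcr : (c : ℝ) = R.up.coeff (i - 1) + 1 := by rw [hc]; push_cast; rfl
    refine hF c (eventually_eval_pos_of_succ (d := i) (fun j hj => ?_) ?_ ?_)
    · obtain ⟨k, rfl⟩ : ∃ k, j = k + 1 := ⟨j - 1, by omega⟩
      rw [coeff_add, coeff_sub, coeff_mul_X, coeff_C_mul, hz _ (by omega), hz _ (by omega),
        coeff_upPoly, coeff_eq_zero_of_natDegree_lt (by omega)]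
      simp
    · rw [coeff_add, coeff_sub, coeff_mul_X, coeff_C_mul, hz (i + 1) (by omega),
        coeff_sub, coeff_downPoly, coeff_upPoly, coeff_upPoly, hup]
      linarith
    · have hlow : -(R.up.coeff (i - 1) : ℝ) ≤ ((R.downPoly - R.upPoly) * X).coeff i := by
        cases i with
        | zero => simp
        | succ i =>
          rw [coeff_mul_X, coeff_sub, coeff_downPoly, coeff_upPoly, Nat.add_sub_cancel]
          have : (0 : ℝ) ≤ R.down.coeff i := Nat.cast_nonneg _
          linarith
      rw [coeff_add, coeff_sub, coeff_C_mul, coeff_sub, coeff_downPoly, coeff_upPoly, hcr]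
      have h5 : (0 : ℝ) ≤ R.up.coeff (i - 1) := Nat.cast_nonneg _
      have h6 : (0 : ℝ) ≤ R.down.coeff i := Nat.cast_nonneg _
      nlinarith

theorem GeometricCase.exists_ratio_le (h : R.GeometricCase) :
    ∃ (α : ℝ) (n₀ : ℕ), 0 < α ∧ α < 1 ∧ ∀ n, n₀ ≤ n → R.ratio n ≤ α := by
  obtain ⟨hd, hlt⟩ : R.down.natDegree ≤ R.up.natDegree ∧
      R.down.coeff R.up.natDegree < R.up.coeff R.up.natDegree := by
    rcases h with ⟨hd, h⟩ | h
    · exact ⟨hd.ge, by rwa [hd]⟩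
    · refine ⟨h.le, ?_⟩
      rw [coeff_eq_zero_of_natDegree_lt h]
      exact R.up_lead_pos
  set a : ℝ := (R.down.coeff R.up.natDegree : ℝ) with ha
  set b : ℝ := (R.up.coeff R.up.natDegree : ℝ) with hb
  have hab : a < b := Nat.cast_lt.2 hlt
  have ha0 : 0 ≤ a := Nat.cast_nonneg _
  -- The constant is the midpoint between the limit a/b of the ratios and 1.
  have hev : ∀ᶠ n : ℕ in atTop, 0 < (C ((a + b) / (2 * b)) * R.upPoly - R.downPoly).eval (n : ℝ) := by
    refine eventually_eval_pos (d := R.up.natDegree) (fun i hi => ?_) ?_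
    · rw [coeff_sub, coeff_C_mul, coeff_upPoly, coeff_downPoly, coeff_eq_zero_of_natDegree_lt hi,
        coeff_eq_zero_of_natDegree_lt (hd.trans_lt hi)]
      simp
    · rw [coeff_sub, coeff_C_mul, coeff_upPoly, coeff_downPoly, ← ha, ← hb]
      have hb0 : b ≠ 0 := by linarith
      have : (a + b) / (2 * b) * b = (a + b) / 2 := by field_simp
      rw [this]
      linarith
  obtain ⟨n₀, hn₀⟩ := eventually_atTop.1 hev
  have hb0 : 0 < b := by linarith
  refine ⟨(a + b) / (2 * b), n₀, by positivity, ?_, fun n hn => ?_⟩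
  · rw [div_lt_one (by positivity)]
    linarith
  · have h1 := hn₀ n hn
    rw [eval_sub, eval_mul, eval_C, eval_upPoly, eval_downPoly] at h1
    have h4 : (0 : ℝ) < R.wUp n := by exact_mod_cast R.wUp_pos n
    rw [ratio, div_le_iff₀ h4]
    linarith

/-- Cleared of denominators, the bound says (W(n,n+1) - W(n,n-1)) n ≥ β W(n,n+1). The coefficient of
n^d in the difference of the two sides is a_d (α_W - β) > 0. -/
theorem PowerCase.exists_ratio_le (h : R.PowerCase) {β : ℝ} (hβ : β < R.drift) :
    ∃ n₀ : ℕ, 1 ≤ n₀ ∧ ∀ n : ℕ, n₀ ≤ n → R.ratio n ≤ 1 - β / n := by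
  obtain ⟨hd, i, hi, hi1, -⟩ := h
  have hz : ∀ j, i < j → (R.upPoly - R.downPoly).coeff j = 0 := fun j hj => by
    rw [coeff_sub, coeff_downPoly, coeff_upPoly, hi.coeff_eq hj, sub_self]
  have hlead : (0 : ℝ) < R.down.coeff (i + 1) := by
    rw [hi1]
    exact_mod_cast R.down_lead_pos
  have hup : R.up.coeff (i + 1) = R.down.coeff (i + 1) := (hi.coeff_eq (by omega)).symm
  rw [drift, ← hi1, Nat.add_sub_cancel, lt_div_iff₀ hlead] at hβ
  have hev : ∀ᶠ n : ℕ in atTop,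
      0 < ((R.upPoly - R.downPoly) * X - C β * R.upPoly).eval (n : ℝ) := by
    refine eventually_eval_pos (d := i + 1) (fun j hj => ?_) ?_
    · obtain ⟨k, rfl⟩ : ∃ k, j = k + 1 := ⟨j - 1, by omega⟩
      rw [coeff_sub, coeff_mul_X, coeff_C_mul, hz _ (by omega), coeff_upPoly,
        coeff_eq_zero_of_natDegree_lt (by omega)]
      simp
    · rw [coeff_sub, coeff_mul_X, coeff_C_mul, coeff_sub, coeff_downPoly, coeff_upPoly,
        coeff_upPoly, hup]
      linarith
  obtain ⟨n₀, hn₀⟩ := eventually_atTop.1 hev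
  refine ⟨max n₀ 1, le_max_right _ _, fun n hn => ?_⟩
  have h1 := hn₀ n ((le_max_left _ _).trans hn)
  have h2 : (0 : ℝ) < n := by exact_mod_cast ((le_max_right n₀ 1).trans hn)
  rw [eval_sub, eval_mul, eval_mul, eval_sub, eval_C, eval_X, eval_upPoly, eval_downPoly] at h1
  have h4 : (0 : ℝ) < R.wUp n := by exact_mod_cast R.wUp_pos n
  rw [ratio, div_le_iff₀ h4, one_sub_mul, le_sub_iff_add_le, div_mul_eq_mul_div,
    ← le_sub_iff_add_le', div_le_iff₀ h2]
  linarith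

theorem GeometricCase.summable (h : R.GeometricCase) : Summable (R.ratioProd 0) := by
  obtain ⟨α, n₀, h0, h1, hr⟩ := h.exists_ratio_le
  exact (R.summable_ratioProd_iff n₀).1 (R.summable_of_ratio_le h0.le h1 hr)

theorem PowerCase.summable (h : R.PowerCase) : Summable (R.ratioProd 0) := by
  have h1 : 1 < R.drift := by
    obtain ⟨-, i, -, -, h1⟩ := h
    exact h1
  obtain ⟨n₀, hn, hr⟩ := h.exists_ratio_le (β := (1 + R.drift) / 2) (by linarith)
  exact (R.summable_ratioProd_iff n₀).1
    (R.summable_of_ratio_le_one_sub (by linarith) hn hr)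

variable (R)

/-- Each case forces its own behaviour of the series, so exhaustiveness alone gives the converse;
disjointness needs no separate proof. -/
theorem not_summable_iff : ¬ Summable (R.ratioProd 0) ↔ R.RecurrentCase := by
  refine ⟨fun h => ?_, fun h => h.not_summable⟩
  rcases R.cases with h1 | h1 | h1
  exacts [h1, absurd h1.summable h, absurd h1.summable h]

theorem summable_iff : Summable (R.ratioProd 0) ↔ R.PowerCase ∨ R.GeometricCase := by
  refine ⟨fun h => ?_, fun h => h.elim PowerCase.summable GeometricCase.summable⟩
  rcases R.cases with h1 | h1
  exacts [absurd h h1.not_summable, h1]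

end Cases

end PolyWalk

/-! ### Computability of the witnesses of divergence. -/

theorem primrec_nat_pow : Primrec₂ ((· ^ ·) : ℕ → ℕ → ℕ) :=
  Primrec₂.unpaired'.1 Nat.Primrec.pow

theorem primrec_nat_log_two : Primrec (Nat.log 2) := by
  have h : PrimrecRel fun n k : ℕ => 2 ^ k ≤ n :=
    Primrec.nat_le.comp (primrec_nat_pow.comp (Primrec.const 2) Primrec.snd) Primrec.fst
  refine (Primrec.nat_findGreatest Primrec.id h).of_eq fun n => ?_
  rw [Nat.findGreatest_eq_iff]
  refine ⟨Nat.log_le_self 2 n, fun h => ?_, fun k hk _ => ?_⟩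
  · exact Nat.pow_log_le_self 2 (fun h0 => h (by simp [show n = 0 from h0]))
  · exact not_le.2 ((Nat.lt_pow_succ_log_self one_lt_two n).trans_le
      (Nat.pow_le_pow_right two_pos hk))

/-- Integer division of K 2^k by m + 1 loses remainder/(m+1) < 1, that is, less than 2^(-k) after
rescaling. -/
theorem ComputableNNReal.const_div {S : Type*} [Primcodable S] {m : S → ℕ} (hm : Computable m)
    (K : ℕ) : ComputableNNReal fun s => (K : ℝ≥0) / (m s + 1) := by
  have hg : Primrec₂ fun a k : ℕ => K * 2 ^ k / (a + 1) :=
    Primrec.nat_div.comp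
      (Primrec.nat_mul.comp (Primrec.const K)
        (primrec_nat_pow.comp (Primrec.const 2) Primrec.snd))
      (Primrec.succ.comp Primrec.fst)
  refine ⟨fun s k => K * 2 ^ k / (m s + 1),
    (Primrec₂.to_comp hg).comp (hm.comp Computable.fst) Computable.snd, fun s k => ?_⟩
  have h2 : (0 : ℝ) < 2 ^ k := by positivity
  have hm1 : (0 : ℝ) < m s + 1 := by positivity
  have h1 := Nat.div_add_mod (K * 2 ^ k) (m s + 1)
  have h3 : (m s + 1 : ℝ) * ((K * 2 ^ k / (m s + 1) : ℕ) : ℝ) + ((K * 2 ^ k % (m s + 1) : ℕ) : ℝ) =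
      K * 2 ^ k := by exact_mod_cast h1
  have h4 : ((K * 2 ^ k % (m s + 1) : ℕ) : ℝ) ≤ m s + 1 := by
    exact_mod_cast (Nat.mod_lt _ (Nat.succ_pos _)).le
  set q : ℝ := ((K * 2 ^ k / (m s + 1) : ℕ) : ℝ)
  set r : ℝ := ((K * 2 ^ k % (m s + 1) : ℕ) : ℝ)
  have hr : 0 ≤ r := Nat.cast_nonneg _
  have e : (((K : ℝ≥0) / (m s + 1) : ℝ≥0) : ℝ) - q / 2 ^ k = r / (m s + 1) / 2 ^ k := by
    push_cast
    field_simp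
    linarith
  rw [e, abs_of_nonneg (by positivity)]
  exact div_le_div_of_nonneg_right ((div_le_one hm1).2 h4) h2.le

theorem ComputableNNReal.natCast {S : Type*} [Primcodable S] (K : ℕ) :
    ComputableNNReal fun _ : S => (K : ℝ≥0) := by
  simpa using ComputableNNReal.const_div (S := S) (Computable.const 0) K

/-! ### Divergence of transient walks, and its failure. -/

namespace PolyWalk

open Filter

variable {R : PolyWalk}

/-- Both transient cases satisfy the estimate that gives polynomial decay. -/
theorem exists_ratio_le_one_sub (h : Summable (R.ratioProd 0)) :
    ∃ (β : ℝ) (n₀ : ℕ), 1 < β ∧ 1 ≤ n₀ ∧ ∀ n : ℕ, n₀ ≤ n → R.ratio n ≤ 1 - β / n := by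
  rcases R.summable_iff.1 h with hp | hg
  · have h1 : 1 < R.drift := by
      obtain ⟨-, i, -, -, h1⟩ := hp
      exact h1
    obtain ⟨n₀, hn, hr⟩ := hp.exists_ratio_le (β := (1 + R.drift) / 2) (by linarith)
    exact ⟨_, n₀, by linarith, hn, hr⟩
  · obtain ⟨α, n₀, h0, h1, hr⟩ := hg.exists_ratio_le
    obtain ⟨m, hm⟩ := exists_nat_gt (2 / (1 - α))
    -- A geometric bound α is below 1 - 2/n as soon as n ≥ 2/(1-α).
    refine ⟨2, max n₀ (max m 1), one_lt_two, (le_max_right _ _).trans (le_max_right _ _),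
      fun n hn => (hr n ((le_max_left _ _).trans hn)).trans ?_⟩
    have hn1 : 1 ≤ n := ((le_max_right _ _).trans (le_max_right _ _)).trans hn
    have hnm : m ≤ n := ((le_max_left _ _).trans (le_max_right _ _)).trans hn
    have hn0 : (0 : ℝ) < n := by exact_mod_cast hn1
    have hnm' : (m : ℝ) ≤ n := by exact_mod_cast hnm
    rw [div_lt_iff₀ (by linarith)] at hm
    rw [le_sub_comm, div_le_iff₀ hn0]
    have := mul_le_mul_of_nonneg_right hnm' (by linarith : 0 ≤ 1 - α)
    linarith

theorem exists_mul_log_le_rpow {ε : ℝ} (hε : 0 < ε) :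
    ∃ c : ℝ, 0 < c ∧ ∀ n : ℕ, 1 ≤ n → c * (Nat.log 2 n + 1) ≤ (n : ℝ) ^ ε := by
  have hl : 0 < Real.log 2 := Real.log_pos one_lt_two
  refine ⟨min 1 (Real.log 2 * ε), lt_min one_pos (mul_pos hl hε), fun n hn => ?_⟩
  have h1 : ((2 : ℝ) ^ (Nat.log 2 n : ℝ)) ≤ n := by
    rw [Real.rpow_natCast]
    exact_mod_cast Nat.pow_log_le_self 2 (by omega)
  have h2 := Real.rpow_le_rpow (by positivity) h1 hε.le
  rw [← Real.rpow_mul zero_le_two, Real.rpow_def_of_pos two_pos] at h2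
  have h3 := Real.add_one_le_exp (Real.log 2 * (Nat.log 2 n * ε))
  have h4 := mul_le_mul_of_nonneg_right (min_le_right 1 (Real.log 2 * ε))
    (Nat.cast_nonneg (α := ℝ) (Nat.log 2 n))
  have h5 := min_le_left 1 (Real.log 2 * ε)
  linarith

/-- The exponent β - 1 is an unspecified positive real. Weakening the power to an inverse logarithm
leaves the natural number `K` as the only parameter, so the bound is computable for each walk. -/
theorem exists_reachProb_singleton_le (h : Summable (R.ratioProd 0)) (t : ℕ) :
    ∃ K : ℕ, ∀ n, R.chain.reachProb n {t} ≤ (K : ℝ) / (Nat.log 2 n + 1) := by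
  obtain ⟨β, n₀, hβ, hn₀, hr⟩ := exists_ratio_le_one_sub h
  obtain ⟨c, hc, hlog⟩ := exists_mul_log_le_rpow (sub_pos.2 hβ)
  have hb : 0 < β - 1 := sub_pos.2 hβ
  set N := max n₀ t
  set B : ℝ := ((N : ℝ) + 1) ^ β / (β - 1) with hB
  have hB0 : 0 < B := by positivity
  obtain ⟨K, hK⟩ := exists_nat_ge (B / c)
  -- Below `N` the decay estimate is not available, but there log₂ n + 1 ≤ N makes the bound at
  -- least 1.
  refine ⟨max K N, fun n => ?_⟩
  have hL : (0 : ℝ) < Nat.log 2 n + 1 := by positivity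
  have hKr : (K : ℝ) ≤ (max K N : ℕ) := by exact_mod_cast le_max_left _ _
  have hNr : (N : ℝ) ≤ (max K N : ℕ) := by exact_mod_cast le_max_right _ _
  rw [le_div_iff₀ hL]
  rcases Nat.lt_or_ge n N with hn | hn
  · have h1 : ((Nat.log 2 n : ℝ) + 1) ≤ N := by
      have := Nat.log_le_self 2 n
      exact_mod_cast (by omega : Nat.log 2 n + 1 ≤ N)
    have h2 := R.chain.reachProb_le_one n {t}
    have h3 := mul_le_mul_of_nonneg_right h2 hL.le
    linarith
  · have h1 := R.reachProb_le_of_ratio_le_one_sub hβ hn₀ hr hn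
    have hn1 : 1 ≤ n := (hn₀.trans (le_max_left n₀ t)).trans hn
    have h2 := hlog n hn1
    have hn0 : (0 : ℝ) < n := by exact_mod_cast hn1
    have h3 : (0 : ℝ) < (n : ℝ) ^ (β - 1) := by positivity
    rw [← div_div, ← hB, le_div_iff₀ h3] at h1
    rw [div_le_iff₀ hc] at hK
    have h4 := mul_le_mul_of_nonneg_left h2 (R.chain.reachProb_nonneg n {t})
    have h5 : c * (R.chain.reachProb n {t} * (Nat.log 2 n + 1)) ≤ c * K := by linarith
    exact (le_of_mul_le_mul_left h5 hc).trans hKr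

theorem exists_reachProb_le (h : Summable (R.ratioProd 0)) {A : Set ℕ} (hA : A.Finite) :
    ∃ K : ℕ, ∀ n, R.chain.reachProb n A ≤ (K : ℝ) / (Nat.log 2 n + 1) := by
  induction A, hA using Set.Finite.induction_on with
  | empty => exact ⟨0, fun n => by simp [MarkovChain.reachProb_empty]⟩
  | @insert a A _ _ ih =>
    obtain ⟨K, hK⟩ := ih
    obtain ⟨L, hL⟩ := exists_reachProb_singleton_le h a
    refine ⟨L + K, fun n => ?_⟩
    rw [Set.insert_eq]
    push_cast
    rw [add_div]
    exact (MarkovChain.reachProb_union_le _ _ _ _).trans (add_le_add (hL n) (hK n))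

/-- With f₀ = 1, condition (i) concerns empty sets, and (iii) holds because f₁ tends to 0. -/
theorem divergent_of_reachProb_le {A : Set ℕ} {K : ℕ}
    (hK : ∀ n, R.chain.reachProb n A ≤ (K : ℝ) / (Nat.log 2 n + 1)) (s₀ : ℕ) :
    R.chain.Divergent s₀ A := by
  refine ⟨fun _ => ((1 : ℕ) : ℝ≥0), fun n => (K : ℝ≥0) / (Nat.log 2 n + 1),
    ComputableNNReal.natCast 1, ComputableNNReal.const_div primrec_nat_log_two.to_comp K, ?_, ?_, ?_⟩
  · intro θ h0 h1
    have : {s : ℕ | (((fun _ => ((1 : ℕ) : ℝ≥0)) s : ℝ≥0) : ℝ) ≤ θ} = ∅ := by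
      ext s
      simpa using h1
    rw [this, MarkovChain.reachProb_empty]
    exact h0.le
  · intro s
    push_cast
    exact hK s
  · intro θ h0 h1
    obtain ⟨m, hm⟩ := exists_nat_gt ((K : ℝ) / θ)
    refine (Set.finite_lt_nat (2 ^ m)).subset fun s hs => ?_
    have h2 : θ ≤ (K : ℝ) / (Nat.log 2 s + 1) := by
      have := hs.1.2
      push_cast at this
      exact this
    rw [div_lt_iff₀ h0] at hm
    rw [le_div_iff₀ (by positivity)] at h2
    have h3 : (Nat.log 2 s : ℝ) + 1 ≤ m := by
      by_contra! hlt
      have := mul_lt_mul_of_pos_left hlt h0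
      linarith
    have h4 : Nat.log 2 s + 1 ≤ m := by exact_mod_cast h3
    exact (Nat.lt_pow_succ_log_self one_lt_two s).trans_le (Nat.pow_le_pow_right two_pos h4)

theorem divergent_of_finite (h : Summable (R.ratioProd 0)) (s₀ : ℕ) {A : Set ℕ} (hA : A.Finite) :
    R.chain.Divergent s₀ A := by
  obtain ⟨K, hK⟩ := exists_reachProb_le h hA
  exact divergent_of_reachProb_le hK s₀

theorem divergent_empty (R : PolyWalk) (s₀ : ℕ) : R.chain.Divergent s₀ ∅ :=
  divergent_of_reachProb_le (K := 0) (fun n => by simp [MarkovChain.reachProb_empty]) s₀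

/-- A walk that reaches `A` almost surely from all large states, and all large states almost
surely from `s₀`, is not divergent. -/
theorem not_divergent_of_eventually {s₀ : ℕ} {A : Set ℕ}
    (hA : ∀ᶠ n in atTop, R.chain.reachProb n A = 1) : ¬ R.chain.Divergent s₀ A := by
  rintro ⟨f₀, f₁, -, -, h0, h1, h2⟩
  obtain ⟨N, hN⟩ := eventually_atTop.1 hA
  have hfin := h2 (1 / 2) (by norm_num) (by norm_num)
  rw [postStar_eq_univ, Set.inter_univ] at hfin
  -- Choosing `m` above `s₀` makes the walk pass through it surely, even if it is transient.
  obtain ⟨m, hm, hmem⟩ := (Set.Ici_infinite (max N s₀)).exists_notMem_finite hfin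
  have hm1 : N ≤ m := (le_max_left _ _).trans hm
  have hm2 : s₀ ≤ m := (le_max_right _ _).trans hm
  have h3 : (1 : ℝ) ≤ f₁ m := hN m hm1 ▸ h1 m
  have h4 : (f₀ m : ℝ) ≤ 1 / 2 := by
    by_contra! hlt
    exact hmem ⟨hlt.le, by linarith⟩
  have h5 := h0 (1 / 2) (by norm_num) (by norm_num)
  have h6 : R.chain.reachProb s₀ {m} ≤ R.chain.reachProb s₀ {s | (f₀ s : ℝ) ≤ 1 / 2} :=
    R.chain.reachProb_mono s₀ (by simpa using h4)
  rw [R.reachProb_of_le hm2] at h6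
  norm_num at h5
  linarith

theorem not_divergent_of_not_summable (h : ¬ Summable (R.ratioProd 0)) (s₀ : ℕ) {A : Set ℕ}
    (hA : A.Nonempty) : ¬ R.chain.Divergent s₀ A := by
  obtain ⟨a, ha⟩ := hA
  refine not_divergent_of_eventually (Eventually.of_forall fun n => ?_)
  refine le_antisymm (R.chain.reachProb_le_one _ _) ?_
  rw [← R.reachProb_of_not_summable h n a]
  exact R.chain.reachProb_mono n (by simpa using ha)

end PolyWalk

/-! ### Reduction of the divergence problem to the coefficients. -/

namespace DivInstance

/-- A ray makes every large state a target, which excludes divergence for any walk; the initial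
state plays no role. -/
theorem divergent_iff (x : DivInstance) :
    x.walk.chain.Divergent x.init x.target ↔
      x.ray = none ∧ (x.states = [] ∨ x.walk.PowerCase ∨ x.walk.GeometricCase) := by
  rw [← PolyWalk.summable_iff]
  constructor
  · intro hd
    have hray : x.ray = none := by
      by_contra hne
      obtain ⟨k, hk⟩ := Option.ne_none_iff_exists'.1 hne
      refine PolyWalk.not_divergent_of_eventually (Filter.eventually_atTop.2 ⟨k, fun n hn => ?_⟩) hd
      exact MarkovChain.reachProb_of_mem _ (Or.inr ⟨k, hk, hn⟩)
    refine ⟨hray, ?_⟩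
    by_contra! hcon
    obtain ⟨a, ha⟩ := List.exists_mem_of_ne_nil _ hcon.1
    exact PolyWalk.not_divergent_of_not_summable hcon.2 x.init ⟨a, Or.inl ha⟩ hd
  · rintro ⟨hray, h⟩
    have htarget : x.target = {n | n ∈ x.states} := by
      ext n
      simp [target, hray]
    rw [htarget]
    rcases h with h | h
    · simpa [h] using PolyWalk.divergent_empty x.walk x.init
    · exact PolyWalk.divergent_of_finite h x.init (List.finite_toSet x.states)

end DivInstance

/-! ### The stack machine, its step bound and its auxiliary loops. -/

namespace DivMachine

open Computability (Γ')
open Turing StateTransition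

/-- The contents: the input, an auxiliary stack, two copies of the downward coefficients and the
output. -/
inductive Stk
  | inp | tmp | dn | lead | out
  deriving DecidableEq

instance : Fintype Stk := ⟨{.inp, .tmp, .dn, .lead, .out}, fun k => by cases k <;> decide⟩

/-- The labels of the program. -/
inductive Lbl
  | skip | states | ray | load | copy | cmp | clean
  deriving DecidableEq

instance : Fintype Lbl :=
  ⟨{.skip, .states, .ray, .load, .copy, .cmp, .clean}, fun k => by cases k <;> decide⟩

/-- The stack alphabets. -/
@[reducible] def Sym : Stk → Type
  | .out => Bool
  | _ => Γ'

/-- The finite memory: what has been seen of the target set, the index of the pair of coefficients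
that is being compared (up to `2`), the two running comparisons, the verdict so far, and the
symbols read last. -/
structure Mem where
  seen : Bool
  ray : Bool
  phase : Fin 3
  lo : Fin 3
  hi : Fin 3
  verdict : Option Bool
  x : Option Γ'
  y : Option Γ'
  z : Option Γ'

noncomputable instance : Fintype Mem :=
  Fintype.ofInjective
    (fun v : Mem => (v.seen, v.ray, v.phase, v.lo, v.hi, v.verdict, v.x, v.y, v.z)) <| by
    rintro ⟨⟩ ⟨⟩ h
    simpa using h

/-- The running comparisons start at 1, which turns the test ≤ into the strict one. -/
def Mem.init : Mem := ⟨false, false, 0, 1, 1, none, none, none, none⟩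

def isBit : Option Γ' → Bool
  | some (Γ'.bit _) => true
  | _ => false

def isKet : Option Γ' → Bool
  | some Γ'.ket => true
  | _ => false

theorem isKet_iff (s : Option Γ') : isKet s = true ↔ s = some Γ'.ket := by
  rcases s with _ | _ | _ | _ | _ | _ <;> simp [isKet]

def digit : Option Γ' → ℕ
  | some (Γ'.bit true) => 1
  | _ => 0

theorem digit_le (s : Option Γ') : digit s ≤ 1 := by
  unfold digit; split <;> omega

/-- The effect of one more digit on a running comparison. -/
def carry (e : Fin 3) (a b c : Option Γ') : Fin 3 :=
  ⟨(e.val + digit a + digit b + (1 - digit c)) / 2, by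
    have := digit_le a
    have := digit_le b
    have := e.isLt
    omega⟩

/-- The digits of the leading coefficient are used for the second comparison only. -/
def Mem.lead (v : Mem) : Option Γ' := if v.phase = 1 then v.z else none

def Mem.addDigit (v : Mem) : Mem :=
  { v with lo := carry v.lo v.x v.lead v.y, hi := carry v.hi v.y none v.x }

def Mem.endNumber (v : Mem) : Mem :=
  { v with
    phase := if v.phase = 0 then 1 else 2
    lo := 1
    hi := 1
    verdict :=
      if v.phase = 0 then
        if v.lo = 0 then some true else if v.hi = 0 then some false else none
      else if v.phase = 1 then
        if v.verdict = none then some (decide (v.lo = 0)) else v.verdict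
      else v.verdict }

def Mem.endLists (v : Mem) : Mem :=
  { v with
    verdict :=
      if v.x = some Γ'.ket then
        if v.y = some Γ'.ket then v.verdict else some true
      else some false }

def Mem.answer (v : Mem) : Bool := !v.ray && (!v.seen || v.verdict.getD false)

/-- Pop the stack `k` if the memory satisfies `c`. -/
def popIf (c : Mem → Bool) (k : Stk) (q : TM2.Stmt Sym Lbl Mem) : TM2.Stmt Sym Lbl Mem :=
  .branch c (.pop k (fun v _ => v) q) q

def program : Lbl → TM2.Stmt Sym Lbl Mem
  | .skip => .pop .inp (fun v s => { v with x := s })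
      (.goto fun v => if v.x = some .comma then .states else .skip)
  | .states => .pop .inp (fun v s =>
        { v with x := s, seen := v.seen || (isBit s || decide (s = some Γ'.comma)) })
      (.goto fun v => if v.x = some .ket then .ray else .states)
  | .ray => .pop .inp (fun v s =>
        { v with x := s, ray := v.ray || (isBit s || decide (s = some Γ'.comma)) })
      (.goto fun v => if v.x = some .ket then .load else .ray)
  | .load => .pop .inp (fun v s => { v with x := s })
      (.branch (fun v => v.x = some .bra) (.goto fun _ => .load)
        (.push .tmp (fun v => v.x.getD .blank)
          (.goto fun v => if v.x = some .ket then .copy else .load)))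
  -- The second reversal restores the order of the downward list. The pop at the end removes the
  -- bracket that opens the upward list.
  | .copy => .pop .tmp (fun v s => { v with x := s })
      (.branch (fun v => v.x = none)
        (.pop .inp (fun v s => { v with x := s }) (.goto fun _ => .cmp))
        (.push .dn (fun v => v.x.getD .blank) (.push .lead (fun v => v.x.getD .blank)
          (.goto fun _ => .copy))))
  | .cmp => .peek .dn (fun v s => { v with x := s })
      (.peek .inp (fun v s => { v with y := s })
      (.peek .lead (fun v s => { v with z := s })
      (.branch (fun v => isKet v.x || isKet v.y)
        (.load Mem.endLists (.goto fun _ => .clean))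
        (.branch (fun v => isBit v.x || isBit v.y || isBit v.lead)
          (popIf (fun v => isBit v.x) .dn (popIf (fun v => isBit v.y) .inp
            (popIf (fun v => isBit v.lead) .lead (.load Mem.addDigit (.goto fun _ => .cmp)))))
          (.pop .dn (fun v _ => v) (.pop .inp (fun v _ => v)
            (.load Mem.endNumber (.goto fun _ => .cmp))))))))
  -- The halting convention demands the initial memory and empty stacks apart from the output.
  | .clean => .pop .dn (fun v s => { v with x := s })
      (.pop .inp (fun v s => { v with y := s })
      (.pop .lead (fun v s => { v with z := s })
      (.branch (fun v => v.x = none ∧ v.y = none ∧ v.z = none)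
        (.push .out Mem.answer (.load (fun _ => Mem.init) .halt))
        (.goto fun _ => .clean))))

/-- The machine that decides the divergence problem. -/
noncomputable def machine : FinTM2 where
  K := Stk
  k₀ := .inp
  k₁ := .out
  Γ := Sym
  Λ := Lbl
  main := .skip
  σ := Mem
  initialState := Mem.init
  Γk₀Fin := inferInstanceAs (Fintype Γ')
  m := program

/-- The contents with the given contents. -/
def contents (I A B C : List Γ') (O : List Bool) : ∀ k, List (Sym k)
  | .inp => I
  | .tmp => A
  | .dn => B
  | .lead => C
  | .out => O

section Stacks

variable (I A B C : List Γ') (O : List Bool)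

@[simp] theorem contents_inp : contents I A B C O .inp = I := rfl
@[simp] theorem contents_tmp : contents I A B C O .tmp = A := rfl
@[simp] theorem contents_dn : contents I A B C O .dn = B := rfl
@[simp] theorem contents_lead : contents I A B C O .lead = C := rfl
@[simp] theorem contents_out : contents I A B C O .out = O := rfl

@[simp] theorem update_inp (l : List Γ') :
    Function.update (contents I A B C O) .inp l = contents l A B C O := by
  funext k; cases k <;> rfl

@[simp] theorem update_tmp (l : List Γ') :
    Function.update (contents I A B C O) .tmp l = contents I l B C O := by
  funext k; cases k <;> rfl

@[simp] theorem update_dn (l : List Γ') :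
    Function.update (contents I A B C O) .dn l = contents I A l C O := by
  funext k; cases k <;> rfl

@[simp] theorem update_lead (l : List Γ') :
    Function.update (contents I A B C O) .lead l = contents I A B l O := by
  funext k; cases k <;> rfl

@[simp] theorem update_out (l : List Bool) :
    Function.update (contents I A B C O) .out l = contents I A B C l := by
  funext k; cases k <;> rfl

end Stacks

abbrev Config := TM2.Cfg Sym Lbl Mem

def config (l : Option Lbl) (v : Mem) (I A B C : List Γ') (O : List Bool) : Config :=
  ⟨l, v, contents I A B C O⟩

/-- The part of the potential that depends on the label. -/
def rank : Option Lbl → ℕ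
  | none => 0
  | some .clean => 1
  | some .cmp => 2
  | some _ => 3

/-- A bound on the number of the remaining steps. -/
def potential (c : Config) : ℕ :=
  -- A symbol moved from input to `tmp` costs 4 and returns 3; duplicated from `tmp`, it costs 3 and
  -- returns 1 + 1. The rank pays for changes of phase that pop nothing.
  rank c.l + 4 * (c.stk .inp).length + 3 * (c.stk .tmp).length + (c.stk .dn).length +
    (c.stk .lead).length

/-- `c` leads to `c'` in a number of steps paid for by the potential. -/
def Run (c c' : Config) : Prop :=
  ∃ n, (flip bind (TM2.step program))^[n] (some c) = some c' ∧ n + potential c' ≤ potential c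

theorem Run.refl (c : Config) : Run c c := ⟨0, rfl, by omega⟩

theorem Run.trans {a b c : Config} (h₁ : Run a b) (h₂ : Run b c) : Run a c := by
  obtain ⟨m, hm, hm'⟩ := h₁
  obtain ⟨n, hn, hn'⟩ := h₂
  refine ⟨n + m, ?_, by omega⟩
  rw [Function.iterate_add_apply, hm, hn]

theorem Run.step {l : Lbl} {v : Mem} {S : ∀ k, List (Sym k)} {c : Config}
    (h : TM2.stepAux (program l) v S = c)
    (hp : potential c < potential ⟨some l, v, S⟩) : Run ⟨some l, v, S⟩ c := by
  refine ⟨1, ?_, by omega⟩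
  rw [← h]
  rfl

theorem potential_config (l : Option Lbl) (v : Mem) (I A B C : List Γ') (O : List Bool) :
    potential (config l v I A B C O) =
      rank l + 4 * I.length + 3 * A.length + B.length + C.length := rfl

theorem Run.single {l : Lbl} {l' : Option Lbl} {v v' : Mem} {I A B C I' A' B' C' : List Γ'}
    {O O' : List Bool}
    (h : TM2.stepAux (program l) v (contents I A B C O) = config l' v' I' A' B' C' O')
    (hp : rank l' + 4 * I'.length + 3 * A'.length + B'.length + C'.length <
      rank (some l) + 4 * I.length + 3 * A.length + B.length + C.length) :
    Run (config (some l) v I A B C O) (config l' v' I' A' B' C' O') := Run.step h hp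

theorem Run.head {l : Lbl} {l' : Option Lbl} {v v' : Mem} {I A B C I' A' B' C' : List Γ'}
    {O O' : List Bool} {c : Config}
    (h : TM2.stepAux (program l) v (contents I A B C O) = config l' v' I' A' B' C' O')
    (hp : rank l' + 4 * I'.length + 3 * A'.length + B'.length + C'.length <
      rank (some l) + 4 * I.length + 3 * A.length + B.length + C.length)
    (hc : Run (config l' v' I' A' B' C' O') c) :
    Run (config (some l) v I A B C O) c := (Run.single h hp).trans hc

def word (l : List Bool) : List Γ' := l.map Γ'.bit

theorem run_skip (l : List Bool) (v : Mem) (I : List Γ') :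
    ∃ x, Run (config (some .skip) v (word l ++ Γ'.comma :: I) [] [] [] [])
      (config (some .states) { v with x := x } I [] [] [] []) := by
  induction l generalizing v with
  | nil => exact ⟨some .comma, Run.single (by simp [program, word, config]) (by simp [rank, word])⟩
  | cons b l ih =>
    obtain ⟨x, hx⟩ := ih { v with x := some (Γ'.bit b) }
    exact ⟨x, Run.head (by simp [program, word, config]) (by simp [rank, word]) hx⟩

/-- The words in bits and commas. -/
def Plain (l : List Γ') : Prop := ∀ s ∈ l, isBit (some s) || decide (s = Γ'.comma)

theorem Plain.head {s : Γ'} {l : List Γ'} (h : Plain (s :: l)) :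
    isBit (some s) || decide (s = Γ'.comma) := h s (by simp)

theorem Plain.tail {s : Γ'} {l : List Γ'} (h : Plain (s :: l)) : Plain l :=
  fun t ht => h t (by simp [ht])

theorem Plain.ne_ket {s : Γ'} {l : List Γ'} (h : Plain (s :: l)) : s ≠ Γ'.ket := by
  rintro rfl
  exact absurd h.head (by decide)

theorem Plain.ne_bra {s : Γ'} {l : List Γ'} (h : Plain (s :: l)) : s ≠ Γ'.bra := by
  rintro rfl
  exact absurd h.head (by decide)

theorem run_states_body {l : List Γ'} (hl : Plain l) (v : Mem) (I : List Γ') :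
    ∃ x, Run (config (some .states) v (l ++ Γ'.ket :: I) [] [] [] [])
      (config (some .ray) { v with x := x, seen := v.seen || decide (l ≠ []) } I [] [] [] []) := by
  induction l generalizing v with
  | nil => exact ⟨some .ket, Run.single (by simp [program, config, isBit]) (by simp [rank])⟩
  | cons s l ih =>
    obtain ⟨x, hx⟩ := ih hl.tail { v with x := some s, seen := true }
    rw [show (v.seen || decide (s :: l ≠ [])) = true by simp]
    refine ⟨x, Run.head ?_ (by simp [rank]) hx⟩
    have h := hl.head
    simp only [Bool.or_eq_true, decide_eq_true_eq] at h
    rcases h with h | h <;> simp [program, config, hl.ne_ket, h]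

theorem run_states {l : List Γ'} (hl : Plain l) (v : Mem) (I : List Γ') :
    ∃ x, Run (config (some .states) v (Γ'.bra :: (l ++ Γ'.ket :: I)) [] [] [] [])
      (config (some .ray) { v with x := x, seen := v.seen || decide (l ≠ []) } I [] [] [] []) := by
  obtain ⟨x, hx⟩ := run_states_body hl { v with x := some Γ'.bra } I
  exact ⟨x, Run.head (by simp [program, config, isBit]) (by simp [rank]) hx⟩

theorem run_ray_body {l : List Γ'} (hl : Plain l) (v : Mem) (I : List Γ') :
    ∃ x, Run (config (some .ray) v (l ++ Γ'.ket :: I) [] [] [] [])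
      (config (some .load) { v with x := x, ray := v.ray || decide (l ≠ []) } I [] [] [] []) := by
  induction l generalizing v with
  | nil => exact ⟨some .ket, Run.single (by simp [program, config, isBit]) (by simp [rank])⟩
  | cons s l ih =>
    obtain ⟨x, hx⟩ := ih hl.tail { v with x := some s, ray := true }
    rw [show (v.ray || decide (s :: l ≠ [])) = true by simp]
    refine ⟨x, Run.head ?_ (by simp [rank]) hx⟩
    have h := hl.head
    simp only [Bool.or_eq_true, decide_eq_true_eq] at h
    rcases h with h | h <;> simp [program, config, hl.ne_ket, h]

theorem run_ray {l : List Γ'} (hl : Plain l) (v : Mem) (I : List Γ') :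
    ∃ x, Run (config (some .ray) v (Γ'.bra :: (l ++ Γ'.ket :: I)) [] [] [] [])
      (config (some .load) { v with x := x, ray := v.ray || decide (l ≠ []) } I [] [] [] []) := by
  obtain ⟨x, hx⟩ := run_ray_body hl { v with x := some Γ'.bra } I
  exact ⟨x, Run.head (by simp [program, config, isBit]) (by simp [rank]) hx⟩

theorem run_load_body {l : List Γ'} (hl : Plain l) (v : Mem) (I A : List Γ') :
    ∃ x, Run (config (some .load) v (l ++ Γ'.ket :: I) A [] [] [])
      (config (some .copy) { v with x := x } I (Γ'.ket :: (l.reverse ++ A)) [] [] []) := by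
  induction l generalizing v A with
  | nil => exact ⟨some .ket, Run.single (by simp [program, config]) (by simp [rank]; omega)⟩
  | cons s l ih =>
    obtain ⟨x, hx⟩ := ih hl.tail { v with x := some s } (s :: A)
    rw [List.reverse_cons, List.append_assoc, List.singleton_append]
    exact ⟨x, Run.head (by simp [program, config, hl.ne_ket, hl.ne_bra])
      (by simp [rank]; omega) hx⟩

theorem run_load {l : List Γ'} (hl : Plain l) (v : Mem) (I : List Γ') :
    ∃ x, Run (config (some .load) v (Γ'.bra :: (l ++ Γ'.ket :: I)) [] [] [] [])
      (config (some .copy) { v with x := x } I (Γ'.ket :: l.reverse) [] [] []) := by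
  obtain ⟨x, hx⟩ := run_load_body hl { v with x := some Γ'.bra } I []
  rw [List.append_nil] at hx
  exact ⟨x, Run.head (by simp [program, config]) (by simp [rank]) hx⟩

theorem run_copy (s : Γ') (A : List Γ') (v : Mem) (I B C : List Γ') :
    ∃ x, Run (config (some .copy) v (s :: I) A B C [])
      (config (some .cmp) { v with x := x } I [] (A.reverse ++ B) (A.reverse ++ C) []) := by
  induction A generalizing v B C with
  | nil => exact ⟨some s, Run.single (by simp [program, config]) (by simp [rank]; omega)⟩
  | cons a A ih =>
    obtain ⟨x, hx⟩ := ih { v with x := some a } (a :: B) (a :: C)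
    simp only [List.reverse_cons, List.append_assoc, List.singleton_append]
    exact ⟨x, Run.head (by simp [program, config]) (by simp [rank]; omega) hx⟩

theorem run_clean (v : Mem) (I B C : List Γ') :
    Run (config (some .clean) v I [] B C []) (config none Mem.init [] [] [] [] [v.answer]) := by
  induction hn : I.length + B.length + C.length using Nat.strong_induction_on generalizing v I B C with
  | _ n ih =>
    by_cases h : I = [] ∧ B = [] ∧ C = []
    · obtain ⟨rfl, rfl, rfl⟩ := h
      exact Run.single (by simp [program, config, Mem.answer]) (by simp [rank])
    · have hlt : I.tail.length + B.tail.length + C.tail.length < I.length + B.length + C.length := by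
        rcases I with _ | ⟨i, I⟩ <;> rcases B with _ | ⟨b, B⟩ <;> rcases C with _ | ⟨c, C⟩ <;>
          simp at h ⊢ <;> omega
      refine Run.head ?_ ?_ (ih _ (hn ▸ hlt) { v with x := B.head?, y := I.head?, z := C.head? }
        I.tail B.tail C.tail rfl)
      · have h' : (decide (B = []) && (decide (I = []) && decide (C = []))) = false := by
          simpa using fun h1 h2 h3 => h ⟨h2, h1, h3⟩
        simp [program, config, h']
      · simp only [rank, List.length_tail, List.length_nil] at hlt ⊢
        omega

end DivMachine

/-! ### Correctness of the comparison loop. -/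

namespace DivMachine

open Computability (Γ')
open Turing StateTransition

theorem stepAux_popIf (c : Mem → Bool) (k : Stk) (q : TM2.Stmt Sym Lbl Mem) (v : Mem)
    (S : ∀ k, List (Sym k)) :
    TM2.stepAux (popIf c k q) v S =
      TM2.stepAux q v (bif c v then Function.update S k (S k).tail else S) := by
  rw [popIf, TM2.stepAux]
  cases h : c v <;> simp

/-- The memory after reading the tops of the stacks. -/
def Mem.read (v : Mem) (I B C : List Γ') : Mem :=
  { v with x := B.head?, y := I.head?, z := C.head? }

theorem cmp_endLists {v : Mem} {I B C : List Γ'}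
    (h : B.head? = some Γ'.ket ∨ I.head? = some Γ'.ket) :
    TM2.stepAux (program .cmp) v (contents I [] B C []) =
      config (some .clean) (v.read I B C).endLists I [] B C [] := by
  have h' : (isKet B.head? || isKet I.head?) = true := by
    simpa [isKet_iff] using h
  simp [program, config, Mem.read, h']

theorem cmp_digit {v : Mem} {I B C : List Γ'}
    (h : ¬ (B.head? = some Γ'.ket ∨ I.head? = some Γ'.ket))
    (hd : isBit B.head? || isBit I.head? || isBit (v.read I B C).lead) :
    TM2.stepAux (program .cmp) v (contents I [] B C []) =
      config (some .cmp) (v.read I B C).addDigit (if isBit I.head? then I.tail else I) []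
        (if isBit B.head? then B.tail else B)
        (if isBit (v.read I B C).lead then C.tail else C) [] := by
  have h' : (isKet B.head? || isKet I.head?) = false := by
    simpa [← Bool.not_eq_true, isKet_iff] using h
  simp only [Mem.read] at hd
  simp only [program, TM2.stepAux, contents_inp, contents_dn, contents_lead, h', cond_false,
    cond_true, stepAux_popIf, config, Mem.read, hd]
  cases isBit I.head? <;> cases isBit B.head? <;>
    rcases Bool.eq_false_or_eq_true
      (isBit (Mem.lead { v with x := B.head?, y := I.head?, z := C.head? })) with hl | hl <;>
    simp only [hl, Bool.false_eq_true, if_false, if_true, cond_false, cond_true, update_dn, update_inp, update_lead,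
      contents_inp, contents_lead]

theorem cmp_endNumber {v : Mem} {I B C : List Γ'}
    (h : ¬ (B.head? = some Γ'.ket ∨ I.head? = some Γ'.ket))
    (hd : (isBit B.head? || isBit I.head? || isBit (v.read I B C).lead) = false) :
    TM2.stepAux (program .cmp) v (contents I [] B C []) =
      config (some .cmp) (v.read I B C).endNumber I.tail [] B.tail C [] := by
  have h' : (isKet B.head? || isKet I.head?) = false := by
    simpa [← Bool.not_eq_true, isKet_iff] using h
  simp only [Mem.read] at hd
  simp only [program, TM2.stepAux, contents_inp, contents_dn, contents_lead, h', cond_false,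
    hd, config, Mem.read, update_dn, update_inp]

/-- The number with the given binary digits, the least significant one first. -/
def value : List Bool → ℕ
  | [] => 0
  | b :: l => b.toNat + 2 * value l

theorem value_bits (n : ℕ) : value n.bits = n := by
  induction n using Nat.binaryRec' with
  | zero => simp [value]
  | bit b n h ih =>
    rw [Nat.bits_append_bit n b h, value, ih, Nat.bit_val]
    omega

theorem isBit_head_word (X : List Bool) {T : List Γ'} (hT : isBit T.head? = false) :
    isBit (word X ++ T).head? = !X.isEmpty := by
  cases X with
  | nil => simpa [word] using hT
  | cons b X => rfl

/-- An exhausted number goes on contributing the digit 0, so numbers of different lengths can be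
processed in parallel. -/
theorem value_eq_digit (X : List Bool) {T : List Γ'} (hT : isBit T.head? = false) :
    value X = digit (word X ++ T).head? + 2 * value X.tail := by
  cases X with
  | nil =>
    have : digit T.head? = 0 := by
      rcases h : T.head? with _ | _ | b | _ | _ | _ <;> simp_all [isBit, digit]
    simpa [word, value] using this.symm
  | cons b X => cases b <;> simp [word, value, digit]

theorem tail_word (X : List Bool) {T : List Γ'} (hT : isBit T.head? = false) :
    (if isBit (word X ++ T).head? then (word X ++ T).tail else word X ++ T) = word X.tail ++ T := by
  rw [isBit_head_word X hT]
  cases X <;> simp [word]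

theorem head_word_ne_ket (X : List Bool) (T : List Γ') :
    (word X ++ Γ'.comma :: T).head? ≠ some Γ'.ket := by
  cases X <;> simp [word]

/-- The new carry is the truncated ceiling of (e + a + b - c)/2, precisely what an inequality
between integers retains after halving. -/
theorem carry_le_iff (e : Fin 3) (a b c : Option Γ') (m n : ℕ) :
    (carry e a b c).val + m ≤ n ↔
      e.val + digit a + digit b + 2 * m ≤ digit c + 2 * n := by
  have := digit_le c
  simp only [carry]
  omega

/-- The fields of the memory that do not change while two numbers are compared. -/
def Mem.SameStage (v w : Mem) : Prop :=
  v.seen = w.seen ∧ v.ray = w.ray ∧ v.phase = w.phase ∧ v.verdict = w.verdict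

/-- Consuming a digit of each number preserves both inequalities, by `carry_le_iff`. Once all digits
are gone, they say that the carries are 0. -/
theorem run_digits (X Y Z : List Bool) (v : Mem) (I B T : List Γ') (hZ : v.phase ≠ 1 → Z = [])
    (hT : v.phase = 1 → isBit T.head? = false) :
    ∃ v' : Mem, v'.SameStage v ∧
      (v'.lo = 0 ↔ v.lo.val + value X + value Z ≤ value Y) ∧
      (v'.hi = 0 ↔ v.hi.val + value Y ≤ value X) ∧
      Run (config (some .cmp) v (word Y ++ Γ'.comma :: I) [] (word X ++ Γ'.comma :: B)
          (word Z ++ T) [])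
        (config (some .cmp) v' (Γ'.comma :: I) [] (Γ'.comma :: B) T []) := by
  induction hn : X.length + Y.length + Z.length using Nat.strong_induction_on
    generalizing v X Y Z with
  | _ n ih =>
    by_cases h0 : X = [] ∧ Y = [] ∧ Z = []
    · obtain ⟨rfl, rfl, rfl⟩ := h0
      have h3 : ∀ e : Fin 3, e = 0 ↔ e.val ≤ 0 := by decide
      exact ⟨v, ⟨rfl, rfl, rfl, rfl⟩, h3 _, h3 _, Run.refl _⟩
    · have hlt : X.tail.length + Y.tail.length + Z.tail.length < X.length + Y.length + Z.length := by
        rcases X with _ | ⟨i, X⟩ <;> rcases Y with _ | ⟨b, Y⟩ <;> rcases Z with _ | ⟨c, Z⟩ <;>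
          simp at h0 ⊢ <;> omega
      have hc : ∀ L : List Γ', isBit (Γ'.comma :: L).head? = false := fun _ => rfl
      set w := v.read (word Y ++ Γ'.comma :: I) (word X ++ Γ'.comma :: B) (word Z ++ T) with hw
      have hlead : isBit w.lead = !Z.isEmpty ∧ value Z = digit w.lead + 2 * value Z.tail ∧
          (if isBit w.lead then (word Z ++ T).tail else word Z ++ T) = word Z.tail ++ T := by
        by_cases hp : v.phase = 1
        · have : w.lead = (word Z ++ T).head? := by simp [hw, Mem.read, Mem.lead, hp]
          rw [this]
          exact ⟨isBit_head_word Z (hT hp), value_eq_digit Z (hT hp), tail_word Z (hT hp)⟩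
        · have : w.lead = none := by simp [hw, Mem.read, Mem.lead, hp]
          rw [this, hZ hp]
          simp [isBit, digit, value]
      obtain ⟨v', ⟨h1, h2, h3, h4⟩, hlo, hhi, hrun⟩ := ih _ (hn ▸ hlt) X.tail Y.tail Z.tail
        w.addDigit (fun hp => by rw [hZ hp]; rfl) hT rfl
      refine ⟨v', ⟨h1, h2, h3, h4⟩, ?_, ?_, ?_⟩
      · rw [hlo, value_eq_digit X (hc B), value_eq_digit Y (hc I), hlead.2.1]
        have := carry_le_iff w.lo w.x w.lead w.y (value X.tail + value Z.tail) (value Y.tail)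
        rw [← add_assoc] at this
        refine this.trans ?_
        simp only [hw, Mem.read]
        constructor <;> intro h <;> linarith
      · rw [hhi, value_eq_digit X (hc B), value_eq_digit Y (hc I)]
        refine (carry_le_iff w.hi w.y none w.x _ _).trans ?_
        simp only [hw, Mem.read, digit]
        constructor <;> intro h <;> linarith
      · have hstep := cmp_digit (v := v) (I := word Y ++ Γ'.comma :: I)
          (B := word X ++ Γ'.comma :: B) (C := word Z ++ T)
          (not_or.2 ⟨head_word_ne_ket X B, head_word_ne_ket Y I⟩) (by
            rw [← hw, hlead.1, isBit_head_word X (hc B), isBit_head_word Y (hc I)]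
            rcases X with _ | _ <;> rcases Y with _ | _ <;> rcases Z with _ | _ <;> simp at h0 ⊢)
        rw [← hw, hlead.2.2, tail_word X (hc B), tail_word Y (hc I)] at hstep
        refine Run.head hstep ?_ hrun
        simp only [word, List.length_append, List.length_map, List.length_cons,
          List.length_tail] at hlt ⊢
        omega

open DivInstance (encodeNumber encodeNumbers)

theorem encodeNumber_append (n : ℕ) (T : List Γ') :
    encodeNumber n ++ T = word n.bits ++ Γ'.comma :: T := by
  simp [encodeNumber, word]

/-- The verdict after the comparison of a pair of coefficients. -/
def nextVerdict (phase : Fin 3) (verdict : Option Bool) (a c b : ℕ) : Option Bool :=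
  if phase = 0 then if a < b then some true else if b < a then some false else none
  else if phase = 1 then if verdict = none then some (decide (a + c < b)) else verdict
  else verdict

/-- Outside phase 1 the stack `C` is untouched, so the leading coefficient survives the first
comparison and serves as the summand `c` in the second. -/
theorem run_number (a c b : ℕ) (v : Mem) (I B C T : List Γ') (hlo : v.lo = 1) (hhi : v.hi = 1)
    (hC : v.phase = 1 → C = encodeNumber c ++ T) :
    ∃ (v' : Mem) (C' : List Γ'), v'.seen = v.seen ∧ v'.ray = v.ray ∧
      v'.phase = (if v.phase = 0 then 1 else 2) ∧ v'.lo = 1 ∧ v'.hi = 1 ∧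
      v'.verdict = nextVerdict v.phase v.verdict a c b ∧ (v.phase ≠ 1 → C' = C) ∧
      Run (config (some .cmp) v (encodeNumber b ++ I) [] (encodeNumber a ++ B) C [])
        (config (some .cmp) v' I [] B C' []) := by
  obtain ⟨Z, T', hCZ, hZ, hT, hval⟩ : ∃ (Z : List Bool) (T' : List Γ'), C = word Z ++ T' ∧
      (v.phase ≠ 1 → Z = []) ∧ (v.phase = 1 → isBit T'.head? = false) ∧
      (v.phase = 1 → value Z = c) := by
    by_cases hp : v.phase = 1
    · exact ⟨c.bits, Γ'.comma :: T, by rw [hC hp, encodeNumber_append], fun h => absurd hp h,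
        fun _ => rfl, fun _ => value_bits c⟩
    · exact ⟨[], C, rfl, fun _ => rfl, fun h => absurd h hp, fun h => absurd h hp⟩
  obtain ⟨w, ⟨h1, h2, h3, h4⟩, hwlo, hwhi, hrun⟩ := run_digits a.bits b.bits Z v I B T' hZ hT
  rw [value_bits, value_bits] at hwlo hwhi
  refine ⟨(w.read (Γ'.comma :: I) (Γ'.comma :: B) T').endNumber, T', h1, h2, ?_, rfl, rfl, ?_, ?_, ?_⟩
  · simp [Mem.endNumber, Mem.read, h3]
  · simp only [Mem.endNumber, Mem.read, nextVerdict, h3, h4, hwlo, hwhi, hlo, hhi]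
    have e1 : ((1 : Fin 3) : ℕ) = 1 := rfl
    rw [e1]
    by_cases hp0 : v.phase = 0
    · have hz : value Z = 0 := by
        rw [hZ (by rw [hp0]; decide)]; rfl
      simp only [hp0, if_true, hz, add_zero, Nat.one_add_le_iff]
    · by_cases hp1 : v.phase = 1
      · have h10 : ¬ (1 : Fin 3) = 0 := by decide
        simp only [hp1, h10, if_false, hval hp1, add_assoc, Nat.one_add_le_iff]
      · simp only [hp0, hp1, if_false]
  · intro hp
    rw [hCZ, hZ hp]
    rfl
  · rw [encodeNumber_append, encodeNumber_append, hCZ]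
    refine hrun.trans (Run.single (cmp_endNumber (by simp) ?_) (by simp [rank]; omega))
    have : isBit (w.read (Γ'.comma :: I) (Γ'.comma :: B) T').lead = false := by
      by_cases hp : w.phase = 1
      · simpa [Mem.lead, Mem.read, hp] using hT (h3 ▸ hp)
      · simp [Mem.lead, Mem.read, hp, isBit]
    rw [this]
    rfl

/-- A list of numbers with the closing bracket. -/
def closed (l : List ℕ) : List Γ' := l.flatMap encodeNumber ++ [Γ'.ket]

theorem closed_cons (a : ℕ) (l : List ℕ) : closed (a :: l) = encodeNumber a ++ closed l := by
  simp [closed]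

theorem head_closed_cons_ne (a : ℕ) (l : List ℕ) : (closed (a :: l)).head? ≠ some Γ'.ket := by
  rw [closed_cons, encodeNumber_append]
  exact head_word_ne_ket _ _

/-- The verdict at the end of the lists. -/
def lastVerdict (verdict : Option Bool) (m n : ℕ) : Bool :=
  if m < n then true else if n < m then false else verdict.getD false

theorem run_endLists (D U : List ℕ) (v : Mem) (C : List Γ') (h : D = [] ∨ U = []) :
    ∃ (v' : Mem) (I B C' : List Γ'), v'.seen = v.seen ∧ v'.ray = v.ray ∧
      v'.verdict.getD false = lastVerdict v.verdict D.length U.length ∧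
      Run (config (some .cmp) v (closed U) [] (closed D) C [])
        (config (some .clean) v' I [] B C' []) := by
  have hnil : (closed []).head? = some Γ'.ket := rfl
  refine ⟨(v.read (closed U) (closed D) C).endLists, closed U, closed D, C, rfl, rfl, ?_,
    Run.single (cmp_endLists ?_) (by simp [rank])⟩
  · rcases D with _ | ⟨a, D⟩ <;> rcases U with _ | ⟨b, U⟩
    · simp [Mem.endLists, Mem.read, hnil, lastVerdict]
    · simp [Mem.endLists, Mem.read, hnil, lastVerdict, head_closed_cons_ne]
    · simp [Mem.endLists, Mem.read, lastVerdict, head_closed_cons_ne]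
    · simp at h
  · rcases h with rfl | rfl
    · exact Or.inl hnil
    · exact Or.inr hnil

theorem run_rest (D U : List ℕ) (v : Mem) (C : List Γ') (hp : v.phase = 2) (hlo : v.lo = 1)
    (hhi : v.hi = 1) :
    ∃ (v' : Mem) (I B C' : List Γ'), v'.seen = v.seen ∧ v'.ray = v.ray ∧
      v'.verdict.getD false = lastVerdict v.verdict D.length U.length ∧
      Run (config (some .cmp) v (closed U) [] (closed D) C [])
        (config (some .clean) v' I [] B C' []) := by
  induction D generalizing U v with
  | nil => exact run_endLists [] U v C (Or.inl rfl)
  | cons a D ih =>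
    rcases U with _ | ⟨b, U⟩
    · exact run_endLists (a :: D) [] v C (Or.inr rfl)
    · obtain ⟨w, C₁, h1, h2, h3, h4, h5, h6, h7, hrun⟩ := run_number a 0 b v (closed U) (closed D) C []
        hlo hhi (fun h => absurd (hp.symm.trans h) (by decide))
      obtain rfl := h7 (by rw [hp]; decide)
      obtain ⟨v', I, B, C', k1, k2, k3, hrun'⟩ := ih U w (by rw [h3, hp]; rfl) h4 h5
      refine ⟨v', I, B, C', k1.trans h1, k2.trans h2, ?_, ?_⟩
      · rw [k3, h6, hp]
        simp [nextVerdict, lastVerdict]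
      · rw [closed_cons, closed_cons]
        exact hrun.trans hrun'

/-- The transience criterion in terms of the lists of the coefficients, the leading ones first. -/
def Drifts (D U : List ℕ) : Prop :=
  D.length < U.length ∨ D.length = U.length ∧ (D.getD 0 0 < U.getD 0 0 ∨
    D.getD 0 0 = U.getD 0 0 ∧ D.getD 0 0 + D.getD 1 0 < U.getD 1 0)

/-- Only the first two pairs can affect the verdict. The remaining pairs are consumed to compare
lengths, and a difference in length overrides it. -/
theorem run_cmp (a b : ℕ) (D U : List ℕ) (v : Mem) (hp : v.phase = 0) (hlo : v.lo = 1)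
    (hhi : v.hi = 1) :
    ∃ (v' : Mem) (I B C' : List Γ'), v'.seen = v.seen ∧ v'.ray = v.ray ∧
      (v'.verdict.getD false = true ↔ Drifts (a :: D) (b :: U)) ∧
      Run (config (some .cmp) v (closed (b :: U)) [] (closed (a :: D)) (closed (a :: D)) [])
        (config (some .clean) v' I [] B C' []) := by
  obtain ⟨w, C₁, h1, h2, h3, h4, h5, h6, h7, hrun⟩ := run_number a 0 b v (closed U) (closed D)
    (closed (a :: D)) [] hlo hhi (fun h => absurd (hp.symm.trans h) (by decide))
  obtain rfl := h7 (by rw [hp]; decide)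
  rw [hp] at h3 h6
  replace h3 : w.phase = 1 := h3
  by_cases hnil : D = [] ∨ U = []
  · obtain ⟨v', I, B, C', k1, k2, k3, hrun'⟩ := run_endLists D U w (closed (a :: D)) hnil
    refine ⟨v', I, B, C', k1.trans h1, k2.trans h2, ?_, ?_⟩
    · rw [k3, h6]
      rcases D with _ | ⟨a', D⟩ <;> rcases U with _ | ⟨b', U⟩
      · rcases lt_trichotomy a b with h | h | h <;>
          simp [nextVerdict, lastVerdict, Drifts, h, h.not_gt]
      · simp [lastVerdict, Drifts]
      · simp [lastVerdict, Drifts]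
      · simp at hnil
    · rw [closed_cons b, closed_cons a]
      rw [closed_cons a] at hrun hrun'
      exact hrun.trans hrun'
  · obtain ⟨a', D, rfl⟩ := List.exists_cons_of_ne_nil (fun h => hnil (Or.inl h))
    obtain ⟨b', U, rfl⟩ := List.exists_cons_of_ne_nil (fun h => hnil (Or.inr h))
    obtain ⟨w', C₂, g1, g2, g3, g4, g5, g6, -, hrun₂⟩ := run_number a' a b' w (closed U) (closed D)
      (closed (a :: a' :: D)) (closed (a' :: D)) h4 h5 (fun _ => closed_cons _ _)
    obtain ⟨v', I, B, C', k1, k2, k3, hrun₃⟩ := run_rest D U w' C₂ (by rw [g3, h3]; rfl) g4 g5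
    refine ⟨v', I, B, C', (k1.trans g1).trans h1, (k2.trans g2).trans h2, ?_, ?_⟩
    · rw [k3, g6, h6, h3, lastVerdict]
      rcases lt_trichotomy D.length U.length with h | h | h
      · simp [h, Drifts]
      · rcases lt_trichotomy a b with h' | h' | h'
        · simp [h, nextVerdict, Drifts, h']
        · simp [h, nextVerdict, Drifts, h', add_comm]
        · simp [h, nextVerdict, Drifts, h', h'.ne', h'.not_gt]
      · simp [h, Drifts, h.not_gt, h.ne']
    · rw [closed_cons a', closed_cons b'] at hrun
      rw [closed_cons b, closed_cons b', closed_cons a (a' :: D), closed_cons a']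
      rw [closed_cons a, closed_cons a'] at hrun hrun₂
      exact hrun.trans (hrun₂.trans hrun₃)

end DivMachine

/-! ### The criterion on coefficient lists and the complete run. -/

namespace DivMachine

open Computability (Γ')
open Turing StateTransition
open DivInstance (encodeNumber encodeNumbers)

theorem coeffList_eq_cons (P : ℕ[X]) :
    DivInstance.coeffList P = P.coeff P.natDegree :: ((List.range P.natDegree).map P.coeff).reverse := by
  simp [DivInstance.coeffList, List.range_succ, -Polynomial.coeff_natDegree]

theorem length_coeffList (P : ℕ[X]) : (DivInstance.coeffList P).length = P.natDegree + 1 := by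
  simp [DivInstance.coeffList]

theorem coeffList_getD_zero (P : ℕ[X]) : (DivInstance.coeffList P).getD 0 0 = P.coeff P.natDegree := by
  simp [coeffList_eq_cons]

theorem coeffList_getD_one {P : ℕ[X]} {i : ℕ} (h : i + 1 = P.natDegree) :
    (DivInstance.coeffList P).getD 1 0 = P.coeff i := by
  simp [coeffList_eq_cons, ← h, List.range_succ]

theorem coeffList_getD_one_of_natDegree_eq_zero {P : ℕ[X]} (h : P.natDegree = 0) :
    (DivInstance.coeffList P).getD 1 0 = 0 := by
  simp [coeffList_eq_cons, h]

/-- Multiplying α_W > 1 by a_d > 0 turns the real drift condition into an inequality between natural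
numbers. -/
theorem drifts_iff (R : PolyWalk) :
    Drifts (DivInstance.coeffList R.down) (DivInstance.coeffList R.up) ↔ R.PowerCase ∨ R.GeometricCase := by
  simp only [Drifts, length_coeffList, coeffList_getD_zero, add_lt_add_iff_right, add_left_inj]
  constructor
  · rintro (h | ⟨hd, h | ⟨h, h1⟩⟩)
    · exact Or.inr (Or.inr h)
    · exact Or.inr (Or.inl ⟨hd.symm, by rwa [← hd] at h⟩)
    · left
      obtain ⟨i, hi⟩ : ∃ i, i + 1 = R.down.natDegree := by
        -- In degree 0 the missing second coefficient defaults to 0, and nothing is smaller than 0.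
        refine ⟨R.down.natDegree - 1, Nat.succ_pred_eq_of_ne_zero fun h0 => ?_⟩
        rw [coeffList_getD_one_of_natDegree_eq_zero (P := R.up) (hd ▸ h0)] at h1
        omega
      rw [coeffList_getD_one hi, coeffList_getD_one (hd ▸ hi), ← hi] at h1
      rw [← hd, ← hi] at h
      have hlead := R.down_lead_pos
      rw [← hi] at hlead
      refine ⟨hd.symm, i, ⟨show R.down.coeff i ≠ R.up.coeff i by omega, fun j hj => ?_⟩, hi, ?_⟩
      · by_contra! hlt
        refine hj ?_
        rcases (Nat.succ_le_of_lt hlt).eq_or_lt with rfl | hlt'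
        · exact h
        · rw [coeff_eq_zero_of_natDegree_lt (by omega), coeff_eq_zero_of_natDegree_lt (by omega)]
      · have h2 : (0 : ℝ) < R.down.coeff (i + 1) := by exact_mod_cast hlead
        have h3 : (R.down.coeff (i + 1) : ℝ) + R.down.coeff i < R.up.coeff i := by exact_mod_cast h1
        rw [PolyWalk.drift, ← hi, Nat.add_sub_cancel, lt_div_iff₀ h2]
        linarith
  · rintro (⟨hd, i, hi, hid, h⟩ | ⟨hd, h⟩ | h)
    · have h0 : R.down.coeff R.down.natDegree = R.up.coeff R.up.natDegree := by
        rw [hd, hi.coeff_eq (by omega)]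
      refine Or.inr ⟨hd.symm, Or.inr ⟨h0, ?_⟩⟩
      rw [coeffList_getD_one hid, coeffList_getD_one (hd ▸ hid)]
      have h2 : (0 : ℝ) < R.down.coeff R.down.natDegree := by exact_mod_cast R.down_lead_pos
      rw [PolyWalk.drift, lt_div_iff₀ h2, ← hid, Nat.add_sub_cancel] at h
      rw [← hid]
      have h3 : (R.down.coeff (i + 1) : ℝ) + R.down.coeff i < R.up.coeff i := by linarith
      exact_mod_cast h3
    · exact Or.inr ⟨hd.symm, Or.inl (by rwa [hd])⟩
    · exact Or.inl h

theorem plain_flatMap (l : List ℕ) : Plain (l.flatMap encodeNumber) := by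
  intro s hs
  simp only [List.mem_flatMap, encodeNumber, List.mem_append, List.mem_map,
    List.mem_singleton] at hs
  rcases hs with ⟨n, -, ⟨b, -, rfl⟩ | rfl⟩ <;> rfl

theorem flatMap_encodeNumber_ne_nil_iff (l : List ℕ) : l.flatMap encodeNumber ≠ [] ↔ l ≠ [] := by
  cases l <;> simp [encodeNumber]

theorem encodeNumbers_append (l : List ℕ) (T : List Γ') :
    encodeNumbers l ++ T = Γ'.bra :: (l.flatMap encodeNumber ++ Γ'.ket :: T) := by
  simp [encodeNumbers]

theorem run_encode (x : DivInstance) :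
    ∃ b : Bool, (b = true ↔ x.walk.chain.Divergent x.init x.target) ∧
      Run (config (some .skip) Mem.init x.encode [] [] [] [])
        (config none Mem.init [] [] [] [] [b]) := by
  set D := DivInstance.coeffList x.walk.down with hD
  set U := DivInstance.coeffList x.walk.up with hU
  have hword : x.encode = word x.init.bits ++ Γ'.comma :: (Γ'.bra :: (x.states.flatMap encodeNumber ++
      Γ'.ket :: (Γ'.bra :: (x.ray.toList.flatMap encodeNumber ++ Γ'.ket ::
        (Γ'.bra :: (D.flatMap encodeNumber ++ Γ'.ket :: (Γ'.bra :: closed U))))))) := by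
    have hlast : encodeNumbers U = Γ'.bra :: closed U := rfl
    rw [DivInstance.encode, List.append_assoc, List.append_assoc, List.append_assoc,
      encodeNumber_append, encodeNumbers_append, encodeNumbers_append, encodeNumbers_append, hlast]
  obtain ⟨x₁, h1⟩ := run_skip x.init.bits Mem.init (Γ'.bra :: (x.states.flatMap encodeNumber ++
      Γ'.ket :: (Γ'.bra :: (x.ray.toList.flatMap encodeNumber ++ Γ'.ket ::
        (Γ'.bra :: (D.flatMap encodeNumber ++ Γ'.ket :: (Γ'.bra :: closed U)))))))
  obtain ⟨x₂, h2⟩ := run_states (plain_flatMap x.states) _ _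
  obtain ⟨x₃, h3⟩ := run_ray (plain_flatMap x.ray.toList) _ _
  obtain ⟨x₄, h4⟩ := run_load (plain_flatMap D) _ _
  obtain ⟨x₅, h5⟩ := run_copy Γ'.bra (Γ'.ket :: (D.flatMap encodeNumber).reverse) _ (closed U) [] []
  have hcl : (Γ'.ket :: (D.flatMap encodeNumber).reverse).reverse ++ [] = closed D := by
    simp [closed]
  rw [hcl] at h5
  have hDc := coeffList_eq_cons x.walk.down
  have hUc := coeffList_eq_cons x.walk.up
  rw [← hD] at hDc
  rw [← hU] at hUc
  obtain ⟨v, I, B, C, k1, k2, k3, h6⟩ := run_cmp (x.walk.down.coeff x.walk.down.natDegree)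
    (x.walk.up.coeff x.walk.up.natDegree)
    ((List.range x.walk.down.natDegree).map x.walk.down.coeff).reverse
    ((List.range x.walk.up.natDegree).map x.walk.up.coeff).reverse
    ⟨false || decide (x.states.flatMap encodeNumber ≠ []),
      false || decide (x.ray.toList.flatMap encodeNumber ≠ []), 0, 1, 1, none, x₅, none, none⟩ rfl rfl rfl
  rw [← hDc, ← hUc] at k3 h6
  refine ⟨v.answer, ?_, ?_⟩
  · rw [hD, hU, drifts_iff] at k3
    rw [DivInstance.divergent_iff, ← k3, Mem.answer, k1, k2]
    simp only [flatMap_encodeNumber_ne_nil_iff]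
    rcases x.ray with _ | k <;> simp
  · rw [hword]
    exact h1.trans (h2.trans (h3.trans (h4.trans (h5.trans (h6.trans (run_clean v I B C))))))

theorem initList_eq (w : List Γ') :
    initList machine w = config (some .skip) Mem.init w [] [] [] [] := by
  refine congrArg (fun S => (⟨some .skip, Mem.init, S⟩ : Config)) ?_
  funext k
  cases k <;> rfl

theorem haltList_eq (w : List Bool) :
    haltList machine w = config none Mem.init [] [] [] [] w := by
  refine congrArg (fun S => (⟨none, Mem.init, S⟩ : Config)) ?_
  funext k
  cases k <;> rfl

open Classical in
/-- The machine decides the divergence problem in linear time. -/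
theorem linearTimeDecidable : LinearTimeDecidable DivInstance.encode
    (fun x => x.walk.chain.Divergent x.init x.target) := by
  have hrun : ∀ x : DivInstance, Run (config (some .skip) Mem.init x.encode [] [] [] [])
      (config none Mem.init [] [] [] []
        [decide (x.walk.chain.Divergent x.init x.target)]) := by
    intro x
    obtain ⟨b, hb, h⟩ := run_encode x
    have : decide (x.walk.chain.Divergent x.init x.target) = b := by
      rw [Bool.eq_iff_iff, decide_eq_true_iff, hb]
    rwa [this]
  choose N hN hle using hrun
  refine ⟨fun x => decide (x.walk.chain.Divergent x.init x.target), fun x => decide_eq_true_iff,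
    { tm := machine
      inputAlphabet := Equiv.refl Γ'
      outputAlphabet := Equiv.refl Bool
      time := fun n => 4 * (n + 1)
      outputsFun := fun x =>
        { steps := N x
          evals_in_steps := ?_
          steps_le_m := ?_ } }, 4, fun n => le_rfl⟩
  · have hid : ∀ {α : Type} (l : List α), l.map (Equiv.refl α).invFun = l := fun l => List.map_id l
    have h := hN x
    rw [← initList_eq, ← haltList_eq, ← hid x.encode] at h
    exact h
  -- The initial potential is 4|w| + 3 and the final one is 0.
  · have h := hle x
    rw [potential_config, potential_config] at h
    simp [rank] at h
    omega

end DivMachine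

theorem mainTheorem2 :
    -- the case analysis decides recurrence versus transience
    (∀ R : PolyWalk, R.chain.Irreducible ∧
      (∀ s, R.chain.IsRecurrent s ↔ R.RecurrentCase) ∧
      (∀ s, R.chain.IsTransient s ↔ R.PowerCase ∨ R.GeometricCase)) ∧
    -- recurrent walks are not divergent
    (∀ R : PolyWalk, (∀ s, R.chain.IsRecurrent s) →
      ∀ (s₀ : ℕ) (A : Set ℕ), A.Nonempty → ¬ R.chain.Divergent s₀ A) ∧
    -- transient walks are divergent
    (∀ R : PolyWalk, (∀ s, R.chain.IsTransient s) →
      ∀ (s₀ : ℕ) (A : Set ℕ), A.Finite → R.chain.Divergent s₀ A) ∧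
    -- the hitting probabilities of a transient walk
    (∀ R : PolyWalk, (∀ s, R.chain.IsTransient s) → ∀ t : ℕ,
      Summable (fun j : ℕ => ∏ k ∈ Finset.Ioc t (t + j), R.ratio k) ∧
      ∀ n, t ≤ n → R.chain.reachProb n {t} =
        (∑' j : ℕ, ∏ k ∈ Finset.Ioc t (n + j), R.ratio k) /
          (∑' j : ℕ, ∏ k ∈ Finset.Ioc t (t + j), R.ratio k)) ∧
    (∀ R : PolyWalk, R.GeometricCase → ∃ (α : ℝ) (n₀ : ℕ), 0 < α ∧ α < 1 ∧
      (∀ n, n₀ ≤ n → R.ratio n ≤ α) ∧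
      ∀ t n : ℕ, max n₀ t ≤ n →
        R.chain.reachProb n {t} ≤ α ^ (n - max n₀ t) / (1 - α)) ∧
    (∀ R : PolyWalk, R.PowerCase → ∀ β : ℝ, 1 < β → β < R.drift → ∃ n₀ : ℕ, 1 ≤ n₀ ∧
      (∀ n : ℕ, n₀ ≤ n → R.ratio n ≤ 1 - β / n) ∧
      ∀ t n : ℕ, max n₀ t ≤ n →
        R.chain.reachProb n {t} ≤
          ((max n₀ t : ℕ) + 1 : ℝ) ^ β / ((β - 1) * (n : ℝ) ^ (β - 1))) ∧
    -- divergence is decidable in linear time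
    LinearTimeDecidable DivInstance.encode
      (fun x => x.walk.chain.Divergent x.init x.target) := by
  refine ⟨fun R => ⟨R.irreducible, fun s => (R.isRecurrent_iff s).trans R.not_summable_iff,
    fun s => (R.isTransient_iff s).trans R.summable_iff⟩, ?_, ?_, ?_, ?_, ?_,
    DivMachine.linearTimeDecidable⟩
  · exact fun R h s₀ A hA =>
      PolyWalk.not_divergent_of_not_summable ((R.isRecurrent_iff 0).1 (h 0)) s₀ hA
  · exact fun R h s₀ A hA => PolyWalk.divergent_of_finite ((R.isTransient_iff 0).1 (h 0)) s₀ hA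
  · intro R h t
    have hs := (R.isTransient_iff 0).1 (h 0)
    refine ⟨(R.summable_ratioProd_iff t).2 hs, fun n hn => ?_⟩
    obtain ⟨j, rfl⟩ := Nat.exists_eq_add_of_le hn
    rw [R.tail_eq t j]
    exact R.reachProb_eq_tail_div hs t j
  · intro R h
    obtain ⟨α, n₀, h0, h1, hr⟩ := h.exists_ratio_le
    exact ⟨α, n₀, h0, h1, hr, fun t n hn => R.reachProb_le_of_ratio_le h0.le h1 hr hn⟩
  · intro R h β hβ hβ'
    obtain ⟨n₀, hn₀, hr⟩ := h.exists_ratio_le hβ'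
    exact ⟨n₀, hn₀, hr, fun t n hn => R.reachProb_le_of_ratio_le_one_sub hβ hn₀ hr hn⟩
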